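/- **The process.** Let $G(0)$ be the complete graph on a set $V_G$ of $n$ vertices. Given $G(i)$, choose a triangle of $G(i)$ uniformly at random and delete its three edges to obtain $G(i+1)$; the process terminates (and $G$ stays constant from then on) once no triangle remains. After $i$ steps write $$t=\frac{i}{n^2},\qquad p=p(t)=1-\frac{6i}{n^2}=1-6t,\qquad \zeta=\zeta(t)=n^{-1/2}p^{-1}\log n .$$ Let $Y_u$, $Y_{u,v}$ and $Q$ be the degree of $u$, the number of common neighbours of $u,v$, and the number of triangles in $G(i)$. Fix a constant $C>0$ and a function $\omega(n)\to\infty$. Let $\tau_\star$ be the first time $t=i/n^2>0$ at which at least one of the following is violated: * $|Y_u/(np)-1|<C\zeta$ for all $u\in V_G$; * $|Y_{u,v}/(np^2)-1|<C\zeta$ for all distinct $u,v\in V_G$; * $|Q/(\tfrac16n^3p^3)-1|<C\zeta^2$; * $\log(1/\zeta)/\log\log n\ge\omega(n)$. **Extension graphs.** An extension graph is a finite graph $H=(V_H,E_H)$ together with a set $I_H\subseteq V_H$ of distinguished vertices that is independent in $H$. Put $v_H=|V_H|$, $e_H=|E_H|$, $\iota_H=|I_H|$, $\rho_H=3\exp(v_H-\iota_H)$,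 and define the scaling $\mathcal S_H(t)=n^{v_H-\iota_H}p(t)^{e_H}$. A subextension $K\subset H$ is a subgraph $K=(V_K,E_K)$ of $H$, with $V_K\subseteq V_H$ and $E_K\subseteq E_H$, having the same distinguished set $I_K=I_H\subseteq V_K$; $K=H$ is allowed. The quotient $H/K$ is the graph $(V_H,E_H\setminus E_K)$ with distinguished vertex set $V_K$, so that $\mathcal S_{H/K}(t)=n^{v_H-v_K}p(t)^{e_H-e_K}$. For an injection $\varphi:I_H\to V_G$ let $\Psi_{H,\varphi}(t)$ be the number of injective maps $\psi:V_H\to V_G$ with $\psi|_{I_H}=\varphi$ such that $\psi(u)\psi(v)$ is an edge of $G(i)$ for every $uv\in E_H$. **Statement.** Fix $L$. There is a sequence $\varepsilon(n)\to0$, depending only on $L$, $C$ and $\omega$, such that with probability tending to $1$ as $n\to\infty$ the following holds simultaneously for all times $t=i/n^2$ with $0<t\le\tau_\star$, all extension graphs $H$ with $v_H\le L$, and all injections $\varphi:I_H\to V_G$: 1. if $\mathcal S_K(t)\ge1$ for all subextensions $K\subset H$, then $\Psi_{H,\varphi}(t)\le(1+\varepsilon(n))\,\mathcal S_H(t)\,(\log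 n)^{\rho_H}$; 2. if $\mathcal S_{H/K}(t)\le1$ for all subextensions $K\subset H$, then $\Psi_{H,\varphi}(t)\le(1+\varepsilon(n))\,(\log n)^{\rho_H}$. -/

import Mathlib

open Filter Topology

noncomputable section

namespace TriangleRemoval

/-! ### The random triangle removal model -/

open Classical in
/-- One step: choose a triangle of `G` uniformly at random and delete its three edges.
If `G` has no triangle the evolution has terminated and `G` is kept. -/
def step {n : ℕ} (G : SimpleGraph (Fin n)) : PMF (SimpleGraph (Fin n)) :=
  if h : (G.cliqueFinset 3).Nonempty then
    (PMF.uniformOfFinset (G.cliqueFinset 3) h).map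
      fun T => G.deleteEdges (T.sym2 : Set (Sym2 (Fin n)))
  else PMF.pure G

/-- The law of the trajectory `(G(0), G(1), …)` run for `m` steps from the complete graph `G(0)` on
`n` vertices; from time `m` on the trajectory is constant. -/
def pathLaw (n : ℕ) : ℕ → PMF (ℕ → SimpleGraph (Fin n))
  | 0 => PMF.pure fun _ => ⊤
  | m + 1 => (pathLaw n m).bind fun g =>
      (step (g m)).map fun G' => fun j => if j ≤ m then g j else G'

/-- The law of the whole trajectory of the random triangle removal started from the complete graph
on `n` vertices. Each step before termination deletes three of the `n(n-1)/2` edges, so that after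
`n ^ 2` steps it has terminated, and it is constant from termination on. -/
def removalLaw (n : ℕ) : PMF (ℕ → SimpleGraph (Fin n)) := pathLaw n (n ^ 2)

/-- The edge density `p = 1 - 6t` at time `t = i / n ^ 2`, that is, after `i` steps. -/
def p (n i : ℕ) : ℝ := 1 - 6 * (i : ℝ) / (n : ℝ) ^ 2

/-- `ζ = n^{-1/2} p^{-1} log n` after `i` steps. -/
def zeta (n i : ℕ) : ℝ := (n : ℝ) ^ (-(1 / 2) : ℝ) * (p n i)⁻¹ * Real.log n

/-- Degrees and co-degrees are within a relative error `C ζ`, and the number of triangles is within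
a relative error `C ζ ^ 2`, of their values in a random graph of density `p`. -/
def DegreeControl (C : ℝ) {n : ℕ} (g : ℕ → SimpleGraph (Fin n)) (i : ℕ) : Prop :=
  (∀ u, |(((g i).neighborSet u).ncard : ℝ) / (n * p n i) - 1| < C * zeta n i) ∧
  (∀ u v, u ≠ v →
    |(((g i).commonNeighbors u v).ncard : ℝ) / (n * p n i ^ 2) - 1| < C * zeta n i) ∧
  |(((g i).cliqueSet 3).ncard : ℝ) / (1 / 6 * (n : ℝ) ^ 3 * p n i ^ 3) - 1| < C * zeta n i ^ 2

/-- The number of steps `i` at the time `τ⋆ = i / n ^ 2`: the first `i > 0` at which the control of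
degrees, co-degrees and triangles with constant `C`, or the bound `log (1/ζ) / log log n ≥ w`, is
violated. There is such an `i` when `n ≥ 1`, since the former fails as soon as `p ≤ 0`. -/
def tauStar (C w : ℝ) {n : ℕ} (g : ℕ → SimpleGraph (Fin n)) : ℕ :=
  sInf {i | 0 < i ∧
    ¬ (DegreeControl C g i ∧ w ≤ Real.log (1 / zeta n i) / Real.log (Real.log n))}

/-! ### Extension graphs -/

/-- A finite graph with vertex labels from `α`, together with a set of distinguished vertices. -/
structure RootedGraph (α : Type*) where
  verts : Finset α
  graph : SimpleGraph α
  roots : Finset α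
  mem_of_adj : ∀ ⦃u v⦄, graph.Adj u v → u ∈ verts
  roots_subset : roots ⊆ verts

namespace RootedGraph

variable {α : Type*}

/-- An extension graph is a rooted graph whose distinguished vertices form an independent set. -/
def IsExtension (H : RootedGraph α) : Prop := H.graph.IsIndepSet (H.roots : Set α)

/-- `v_H`. -/
def v (H : RootedGraph α) : ℕ := H.verts.card

/-- `ι_H`. -/
def iota (H : RootedGraph α) : ℕ := H.roots.card

/-- `e_H`. -/
def e (H : RootedGraph α) : ℕ := H.graph.edgeSet.ncard

/-- The scaling `S_H(n, p) = n^{v_H - ι_H} p^{e_H}`. The subtraction is exact as `ι_H ≤ v_H`. -/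
def scaling (H : RootedGraph α) (n : ℕ) (p : ℝ) : ℝ := (n : ℝ) ^ (H.v - H.iota) * p ^ H.e

/-- `ρ_H = 3 exp (v_H - ι_H)`. -/
def rho (H : RootedGraph α) : ℝ := 3 * Real.exp ((H.v : ℝ) - (H.iota : ℝ))

/-- `K` is a subextension of `H`. -/
structure IsSubextension (K H : RootedGraph α) : Prop where
  verts_subset : K.verts ⊆ H.verts
  graph_le : K.graph ≤ H.graph
  roots_eq : K.roots = H.roots

/-- The quotient `H/K = (V_H, E_H \ E_K)` with distinguished vertex set `V_K`. -/
def quotient (H K : RootedGraph α) (h : K.IsSubextension H) : RootedGraph α where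
  verts := H.verts
  graph := H.graph \ K.graph
  roots := K.verts
  mem_of_adj := fun _ _ huv => H.mem_of_adj huv.1
  roots_subset := h.verts_subset

/-- The number `Ψ_{H,φ}` of injective maps from the vertices of `H` to those of `G` that agree with
`φ` on the distinguished vertices and map edges of `H` to edges of `G`. -/
def Psi (H : RootedGraph α) {n : ℕ} (G : SimpleGraph (Fin n)) (φ : H.roots ↪ Fin n) : ℕ :=
  Nat.card {ψ : H.verts ↪ Fin n //
    (∀ x : H.roots, ψ ⟨x, H.roots_subset x.2⟩ = φ x) ∧
    ∀ a b : H.verts, H.graph.Adj a b → G.Adj (ψ a) (ψ b)}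

end RootedGraph

end TriangleRemoval

end

noncomputable section

namespace TriangleRemoval

/-! The proof is a moment method. While the degrees are controlled, an edge lies in about `n p ^ 2`
of the `n ^ 3 p ^ 3 / 6` triangles, so a step hits a small edge set `F` with probability about `6
|F| / (n ^ 2 p)`. Each step multiplies `p` by `1 - 6 / (n ^ 2 p)`, so the survival probabilities
multiply up to about `p ^ |F|`. For `|F| = O(log n)` the errors cost at most a constant factor per
edge: `F` survives with probability at most `(e ^ 2 p) ^ |F|`
(`pathLaw_toOuterMeasure_subset_le_pow`).

This bounds the moments of order `r = ⌈log n⌉` of the number of copies of `H`. Copies are exposed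
one at a time. If a new copy meets the roots and the exposed vertices exactly in `K`, it contributes
a power of `log n` times `n ^ (v_H - |K|) p ^ e`, where `e` counts the edges of `H` not spanned by
`K`. With `B` a bound on all these quantities, the moment is at most `(O(1) (log n) ^ (v_H - ι_H) B)
^ r` (`sum_mul_card_copies_pow_le`). By Markov's inequality, more than `B (log n) ^ (v_H - ι_H + 1)`
copies have probability at most `n ^ (-(v_H + 4))`, which survives a union bound over times and
roots (`tendsto_removalLaw_lt_card_copies`). One may take `B = S_H` in the first case, since `S_H =
S_K S_{H/K}`, and `B = 1` in the second. -/

/-! ### Moments of the number of copies under a weight on graphs -/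

open Classical in
/-- The injections into `Fin n` that agree with `φ` on `R`. -/
def extensions {V : Type*} [Fintype V] {n : ℕ} (R : Finset V) (φ : V → Fin n) :
    Finset (V → Fin n) :=
  Finset.univ.filter fun ψ => Function.Injective ψ ∧ ∀ x ∈ R, ψ x = φ x

open Classical in
/-- The edges of the image of `H` under `ψ`. -/
def imageEdges {V : Type*} [Fintype V] {n : ℕ} (H : SimpleGraph V) (ψ : V → Fin n) :
    Finset (Sym2 (Fin n)) :=
  H.edgeFinset.image (Sym2.map ψ)

open Classical in
/-- The copies of `H` in `G` that extend `φ` on `R`. -/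
def copies {V : Type*} [Fintype V] {n : ℕ} (H : SimpleGraph V) (R : Finset V) (φ : V → Fin n)
    (G : SimpleGraph (Fin n)) : Finset (V → Fin n) :=
  (extensions R φ).filter fun ψ => ∀ a b, H.Adj a b → G.Adj (ψ a) (ψ b)

open Classical in
/-- The edges of `H` that are not spanned by `K`. -/
def outerEdges {V : Type*} [Fintype V] (H : SimpleGraph V) (K : Finset V) : Finset (Sym2 V) :=
  H.edgeFinset.filter fun e => ¬ ∀ x ∈ e, x ∈ K

theorem imageEdges_subset_edgeSet_iff {V : Type*} [Fintype V] {n : ℕ} (H : SimpleGraph V)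
    (ψ : V → Fin n) (G : SimpleGraph (Fin n)) :
    (imageEdges H ψ : Set (Sym2 (Fin n))) ⊆ G.edgeSet ↔
      ∀ a b, H.Adj a b → G.Adj (ψ a) (ψ b) := by
  classical
  constructor
  · intro h a b hab
    have : Sym2.map ψ s(a, b) ∈ (imageEdges H ψ : Set (Sym2 (Fin n))) := by
      simp only [imageEdges, Finset.coe_image]
      exact ⟨s(a, b), by simpa using hab, rfl⟩
    simpa using h this
  · intro h e he
    simp only [imageEdges, Finset.coe_image] at he
    obtain ⟨e', he', rfl⟩ := he
    induction e' with
    | _ a b => simpa using h a b (by simpa using he')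

/-- An edge of `H` whose image is in `U` has both ends mapped into `W`, so an edge with an end
outside the preimage of `W` yields a new edge. -/
theorem card_outerEdges_le {V : Type*} [Fintype V] {n : ℕ} (H : SimpleGraph V) (R : Finset V)
    {ψ : V → Fin n} (hψ : Function.Injective ψ) (U : Finset (Sym2 (Fin n)))
    (W : Finset (Fin n)) (hU : ∀ e ∈ U, ∀ x ∈ e, x ∈ W) [DecidableEq V] :
    (outerEdges H (R ∪ Finset.univ.filter fun x => ψ x ∈ W)).card ≤
      (imageEdges H ψ \ U).card := by
  classical
  rw [← Finset.card_image_of_injective _ (Sym2.map.injective hψ)]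
  refine Finset.card_le_card fun e he => ?_
  obtain ⟨e', he', rfl⟩ := Finset.mem_image.1 he
  simp only [outerEdges, Finset.mem_filter] at he'
  refine Finset.mem_sdiff.2 ⟨Finset.mem_image_of_mem _ (by convert he'.1), fun h => he'.2 ?_⟩
  intro x hx
  have := hU _ h (ψ x) (Sym2.mem_map.2 ⟨x, hx, rfl⟩)
  simp [this]

/-- Vertices of `R` have one possible image, those of `K \ R` at most `m`, and the others at most
`n`. -/
theorem card_extensions_fiber_le {V : Type*} [Fintype V] [DecidableEq V] {n : ℕ}
    (R : Finset V) (φ : V → Fin n) (W : Finset (Fin n)) {m : ℕ} (hW : W.card ≤ m)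
    (K : Finset V) (hRK : R ⊆ K) :
    ((extensions R φ).filter fun ψ =>
      (R ∪ Finset.univ.filter fun x => ψ x ∈ W) = K).card ≤
      m ^ (K.card - R.card) * n ^ (Fintype.card V - K.card) := by
  classical
  have hsub : ((extensions R φ).filter fun ψ =>
      (R ∪ Finset.univ.filter fun x => ψ x ∈ W) = K) ⊆
      Fintype.piFinset fun x => if x ∈ K then (if x ∈ R then {φ x} else W) else Finset.univ := by
    intro ψ hψ
    simp only [extensions, Finset.mem_filter, Finset.mem_univ, true_and] at hψ
    rw [Fintype.mem_piFinset]
    intro x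
    split_ifs with h1 h2
    · simp [hψ.1.2 x h2]
    · rw [← hψ.2] at h1
      simpa [h2] using h1
    · simp
  refine (Finset.card_le_card hsub).trans ?_
  rw [Fintype.card_piFinset]
  have h : ∀ x : V, (if x ∈ K then (if x ∈ R then ({φ x} : Finset (Fin n)) else W)
      else Finset.univ).card =
      if x ∈ K then (if x ∈ R then 1 else W.card) else n := by
    intro x; split_ifs <;> simp
  simp only [h]
  rw [Finset.prod_ite, Finset.prod_ite, Finset.prod_const_one, one_mul, Finset.prod_const,
    Finset.prod_const]
  have e1 : ((Finset.univ.filter fun x => x ∈ K).filter fun x => x ∉ R).card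
      = K.card - R.card := by
    rw [← Finset.card_sdiff_of_subset hRK]
    congr 1; ext; simp
  have e2 : (Finset.univ.filter fun x => x ∉ K).card = Fintype.card V - K.card := by
    rw [← Finset.card_compl]
    congr 1; ext; simp
  rw [e1, e2]
  gcongr

/-- The cost of one further copy when the edges `U` are already exposed. The maps are grouped by the
set `K` of vertices that are roots or land in `W`; the factor `2 ^ |V|` counts the choices of `K`.
-/
theorem sum_pow_card_imageEdges_sdiff_le {V : Type*} [Fintype V] {n : ℕ} (H : SimpleGraph V)
    (R : Finset V) (φ : V → Fin n) (U : Finset (Sym2 (Fin n))) (W : Finset (Fin n))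
    (hU : ∀ e ∈ U, ∀ x ∈ e, x ∈ W) {m : ℕ} (hm : 1 ≤ m) (hW : W.card ≤ m) {p B : ℝ}
    (hp0 : 0 ≤ p) (hp1 : p ≤ 1)
    (hB : ∀ K : Finset V, R ⊆ K →
      (n : ℝ) ^ (Fintype.card V - K.card) * p ^ (outerEdges H K).card ≤ B) :
    ∑ ψ ∈ extensions R φ, p ^ (imageEdges H ψ \ U).card ≤
      2 ^ Fintype.card V * (m : ℝ) ^ (Fintype.card V - R.card) * B := by
  classical
  have hB0 : 0 ≤ B := le_trans (by positivity) (hB Finset.univ (Finset.subset_univ _))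
  have hm' : (1 : ℝ) ≤ m := by exact_mod_cast hm
  calc ∑ ψ ∈ extensions R φ, p ^ (imageEdges H ψ \ U).card
      ≤ ∑ ψ ∈ extensions R φ,
          p ^ (outerEdges H (R ∪ Finset.univ.filter fun x => ψ x ∈ W)).card := by
        refine Finset.sum_le_sum fun ψ hψ => pow_le_pow_of_le_one hp0 hp1 ?_
        simp only [extensions, Finset.mem_filter, Finset.mem_univ, true_and] at hψ
        convert card_outerEdges_le H R hψ.1 U W hU
    _ = ∑ K : Finset V, ∑ ψ ∈ (extensions R φ).filter fun ψ =>
          (R ∪ Finset.univ.filter fun x => ψ x ∈ W) = K,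
          p ^ (outerEdges H (R ∪ Finset.univ.filter fun x => ψ x ∈ W)).card := by
        rw [Finset.sum_fiberwise]
    _ ≤ ∑ K : Finset V, (m : ℝ) ^ (Fintype.card V - R.card) * B := by
        refine Finset.sum_le_sum fun K _ => ?_
        by_cases hRK : R ⊆ K
        · calc _ = (((extensions R φ).filter fun ψ =>
                (R ∪ Finset.univ.filter fun x => ψ x ∈ W) = K).card : ℝ) *
                p ^ (outerEdges H K).card := by
                rw [← nsmul_eq_mul, ← Finset.sum_const]
                refine Finset.sum_congr rfl fun ψ hψ => ?_
                rw [(Finset.mem_filter.1 hψ).2]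
            _ ≤ ((m : ℝ) ^ (K.card - R.card) * (n : ℝ) ^ (Fintype.card V - K.card)) *
                p ^ (outerEdges H K).card := by
                gcongr
                exact_mod_cast card_extensions_fiber_le R φ W hW K hRK
            _ = (m : ℝ) ^ (K.card - R.card) *
                ((n : ℝ) ^ (Fintype.card V - K.card) * p ^ (outerEdges H K).card) := by ring
            _ ≤ _ := by
                gcongr
                · exact Finset.card_le_univ K
                · exact hB K hRK
        · rw [Finset.filter_false_of_mem, Finset.sum_empty]
          · positivity
          · rintro ψ - rfl
            exact hRK Finset.subset_union_left
    _ = _ := by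
        rw [Finset.sum_const, nsmul_eq_mul, Finset.card_univ, Fintype.card_finset]
        push_cast; ring

-- The exposed edges `U` and vertices `W` are kept general so that the induction on `r` closes: one
-- factor of the moment is expanded as a sum over `ψ`, whose edges and vertices join `U` and `W`.
-- The weight is only assumed to be bounded on sets of at most `N` edges, since survival is only
-- controlled for small sets.
open Classical in
theorem sum_mul_card_copies_pow_le {V : Type*} [Fintype V] {n : ℕ} (H : SimpleGraph V)
    (R : Finset V) (φ : V → Fin n) (ν : SimpleGraph (Fin n) → ℝ)
    {N m : ℕ} (hm : 1 ≤ m) {M p B : ℝ} (hM : 1 ≤ M) (hp0 : 0 ≤ p) (hp1 : p ≤ 1)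
    (hν : ∀ U : Finset (Sym2 (Fin n)), U.card ≤ N →
      ∑ G, (if (U : Set (Sym2 (Fin n))) ⊆ G.edgeSet then ν G else 0) ≤ (M * p) ^ U.card)
    (hB : ∀ K : Finset V, R ⊆ K →
      (n : ℝ) ^ (Fintype.card V - K.card) * p ^ (outerEdges H K).card ≤ B) (r : ℕ) :
    ∀ (U : Finset (Sym2 (Fin n))) (W : Finset (Fin n)), (∀ e ∈ U, ∀ x ∈ e, x ∈ W) →
      U.card + r * H.edgeFinset.card ≤ N → W.card + r * Fintype.card V ≤ m →
      ∑ G, (if (U : Set (Sym2 (Fin n))) ⊆ G.edgeSet then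
        ν G * ((copies H R φ G).card : ℝ) ^ r else 0) ≤
      (M * p) ^ U.card * (M ^ H.edgeFinset.card *
        (2 ^ Fintype.card V * (m : ℝ) ^ (Fintype.card V - R.card) * B)) ^ r := by
  have hB0 : 0 ≤ B := le_trans (by positivity) (hB Finset.univ (Finset.subset_univ _))
  induction r with
  | zero =>
    intro U W hU hN hW
    simpa using hν U (by simpa using hN)
  | succ r ih =>
    intro U W hU hN hW
    set D : ℝ := M ^ H.edgeFinset.card *
        (2 ^ Fintype.card V * (m : ℝ) ^ (Fintype.card V - R.card) * B) with hD
    have hcard : ∀ ψ : V → Fin n, (imageEdges H ψ).card ≤ H.edgeFinset.card :=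
      fun ψ => Finset.card_image_le
    have key : ∀ ψ ∈ extensions R φ, ∑ G, (if ((U ∪ imageEdges H ψ : Finset _) :
        Set (Sym2 (Fin n))) ⊆ G.edgeSet then
        ν G * ((copies H R φ G).card : ℝ) ^ r else 0) ≤
        (M * p) ^ U.card * D ^ r * M ^ H.edgeFinset.card * p ^ (imageEdges H ψ \ U).card := by
      intro ψ hψ
      refine (ih (U ∪ imageEdges H ψ) (W ∪ Finset.univ.image ψ) ?_ ?_ ?_).trans ?_
      · intro e he x hx
        rcases Finset.mem_union.1 he with he | he
        · exact Finset.mem_union_left _ (hU e he x hx)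
        · obtain ⟨e', _, rfl⟩ := Finset.mem_image.1 he
          obtain ⟨y, _, rfl⟩ := Sym2.mem_map.1 hx
          exact Finset.mem_union_right _ (Finset.mem_image_of_mem _ (Finset.mem_univ _))
      · have := Finset.card_union_le U (imageEdges H ψ)
        have := hcard ψ
        rw [add_mul, one_mul] at hN
        omega
      · have := Finset.card_union_le W (Finset.univ.image ψ)
        have : (Finset.univ.image ψ).card ≤ Fintype.card V := Finset.card_image_le
        rw [add_mul, one_mul] at hW
        omega
      -- Only new edges contribute a factor `p`; the accompanying powers of `M` are bounded crudely
      -- by `M ^ e_H`.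
      · have e1 : (U ∪ imageEdges H ψ).card = U.card + (imageEdges H ψ \ U).card := by
          rw [← Finset.union_sdiff_self_eq_union,
            Finset.card_union_of_disjoint Finset.disjoint_sdiff]
        rw [e1, pow_add, mul_pow M p (imageEdges H ψ \ U).card]
        have e2 : M ^ (imageEdges H ψ \ U).card ≤ M ^ H.edgeFinset.card :=
          pow_le_pow_right₀ hM ((Finset.card_le_card Finset.sdiff_subset).trans (hcard ψ))
        have hD0 : 0 ≤ D := by positivity
        calc _ = (M * p) ^ U.card * D ^ r * p ^ (imageEdges H ψ \ U).card *
              M ^ (imageEdges H ψ \ U).card := by ring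
          _ ≤ (M * p) ^ U.card * D ^ r * p ^ (imageEdges H ψ \ U).card *
              M ^ H.edgeFinset.card := by gcongr
          _ = _ := by ring
    calc _ = ∑ G, ∑ ψ ∈ extensions R φ, (if ((U ∪ imageEdges H ψ : Finset _) :
        Set (Sym2 (Fin n))) ⊆ G.edgeSet then
        ν G * ((copies H R φ G).card : ℝ) ^ r else 0) := by
          refine Finset.sum_congr rfl fun G _ => ?_
          simp only [Finset.coe_union, Set.union_subset_iff, imageEdges_subset_edgeSet_iff]
          split_ifs with h
          · simp only [h, true_and]
            rw [← Finset.sum_filter, Finset.sum_const, nsmul_eq_mul, pow_succ]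
            simp only [copies]
            ring
          · simp [h]
      _ = ∑ ψ ∈ extensions R φ, ∑ G, (if ((U ∪ imageEdges H ψ : Finset _) :
        Set (Sym2 (Fin n))) ⊆ G.edgeSet then
        ν G * ((copies H R φ G).card : ℝ) ^ r else 0) := Finset.sum_comm
      _ ≤ ∑ ψ ∈ extensions R φ,
        (M * p) ^ U.card * D ^ r * M ^ H.edgeFinset.card * p ^ (imageEdges H ψ \ U).card :=
          Finset.sum_le_sum key
      _ = (M * p) ^ U.card * D ^ r * M ^ H.edgeFinset.card *
        ∑ ψ ∈ extensions R φ, p ^ (imageEdges H ψ \ U).card := by rw [Finset.mul_sum]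
      _ ≤ (M * p) ^ U.card * D ^ r * M ^ H.edgeFinset.card *
        (2 ^ Fintype.card V * (m : ℝ) ^ (Fintype.card V - R.card) * B) := by
          gcongr
          refine sum_pow_card_imageEdges_sdiff_le H R φ U W hU hm (by omega) hp0 hp1 hB
      _ = _ := by rw [hD]; ring

open Classical in
/-- Markov's inequality for the `r`-th moment of the number of copies. -/
theorem sum_filter_lt_card_copies_le {V : Type*} [Fintype V] {n : ℕ} (H : SimpleGraph V)
    (R : Finset V) (φ : V → Fin n) (ν : SimpleGraph (Fin n) → ℝ) (hν0 : ∀ G, 0 ≤ ν G)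
    {r m : ℕ} (hm : 1 ≤ m) {M p B : ℝ} (hM : 1 ≤ M) (hp0 : 0 ≤ p) (hp1 : p ≤ 1)
    (hν : ∀ U : Finset (Sym2 (Fin n)), U.card ≤ r * H.edgeFinset.card →
      ∑ G, (if (U : Set (Sym2 (Fin n))) ⊆ G.edgeSet then ν G else 0) ≤ (M * p) ^ U.card)
    (hB : ∀ K : Finset V, R ⊆ K →
      (n : ℝ) ^ (Fintype.card V - K.card) * p ^ (outerEdges H K).card ≤ B) (hB0 : 0 < B)
    (hr : r * Fintype.card V ≤ m) {l : ℝ} (hl : 0 < l) :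
    ∑ G with B * l < (copies H R φ G).card, ν G ≤
      (M ^ H.edgeFinset.card * 2 ^ Fintype.card V *
        (m : ℝ) ^ (Fintype.card V - R.card) / l) ^ r := by
  have h := sum_mul_card_copies_pow_le H R φ ν hm hM hp0 hp1 hν hB r ∅ ∅ (by simp) (by simp)
    (by simpa using hr)
  simp only [Finset.coe_empty, Set.empty_subset, if_true, Finset.card_empty, pow_zero,
    one_mul] at h
  have h2 : (∑ G with B * l < (copies H R φ G).card, ν G) * (B * l) ^ r ≤
      ∑ G, ν G * ((copies H R φ G).card : ℝ) ^ r := by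
    rw [Finset.sum_mul]
    refine le_trans (Finset.sum_le_sum fun G hG => ?_)
      (Finset.sum_le_univ_sum_of_nonneg fun G => ?_)
    · exact mul_le_mul_of_nonneg_left
        (pow_le_pow_left₀ (by positivity) (Finset.mem_filter.1 hG).2.le r) (hν0 G)
    · exact mul_nonneg (hν0 G) (by positivity)
  rw [← le_div_iff₀ (by positivity)] at h2
  refine h2.trans ((div_le_div_of_nonneg_right h (by positivity)).trans_eq ?_)
  rw [← div_pow]
  congr 1
  field_simp

/-! ### The effect of one step on a fixed edge set -/

open Classical in
/-- The triangles of `G` that contain the edge `e`. -/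
def trianglesAt {n : ℕ} (G : SimpleGraph (Fin n)) (e : Sym2 (Fin n)) : Finset (Finset (Fin n)) :=
  (G.cliqueFinset 3).filter fun T => e ∈ T.sym2

theorem ncard_commonNeighbors_le_card_trianglesAt {n : ℕ} {G : SimpleGraph (Fin n)} {u v : Fin n}
    (huv : G.Adj u v) : (G.commonNeighbors u v).ncard ≤ (trianglesAt G s(u, v)).card := by
  classical
  rw [Set.ncard_eq_toFinset_card']
  refine Finset.card_le_card_of_injOn (fun w => {u, v, w}) ?_ ?_
  · intro w hw
    have hw' : G.Adj u w ∧ G.Adj v w := by simpa [SimpleGraph.mem_commonNeighbors] using hw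
    simp only [trianglesAt, Finset.coe_filter, Set.mem_ofPred_eq, SimpleGraph.mem_cliqueFinset_iff]
    exact ⟨SimpleGraph.is3Clique_triple_iff.2 ⟨huv, hw'.1, hw'.2⟩, by simp⟩
  · intro w hw w' hw' h
    have hw1 : G.Adj u w ∧ G.Adj v w := by simpa [SimpleGraph.mem_commonNeighbors] using hw
    have : w ∈ ({u, v, w'} : Finset (Fin n)) := by
      rw [← show ({u, v, w} : Finset (Fin n)) = {u, v, w'} from h]; simp
    simp only [Finset.mem_insert, Finset.mem_singleton] at this
    rcases this with h | h | h
    · exact absurd h hw1.1.ne'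
    · exact absurd h hw1.2.ne'
    · exact h

/-- Two distinct edges cover at least three vertices, which determine any triangle containing both.
-/
theorem card_trianglesAt_inter_le_one {n : ℕ} (G : SimpleGraph (Fin n)) {e e' : Sym2 (Fin n)}
    (he : e ∈ G.edgeSet) (he' : e' ∈ G.edgeSet) (hee : e ≠ e') :
    (trianglesAt G e ∩ trianglesAt G e').card ≤ 1 := by
  classical
  induction e with
  | _ a b =>
  induction e' with
  | _ c d =>
    have hab : a ≠ b := SimpleGraph.Adj.ne he
    have hcd : c ≠ d := SimpleGraph.Adj.ne he'
    obtain ⟨x, hx, hxa, hxb⟩ : ∃ x, (x = c ∨ x = d) ∧ x ≠ a ∧ x ≠ b := by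
      by_contra! h
      have h1 := h c (Or.inl rfl)
      have h2 := h d (Or.inr rfl)
      apply hee
      rw [Sym2.eq_iff]
      grind
    have key : ∀ T ∈ trianglesAt G s(a, b) ∩ trianglesAt G s(c, d), T = {a, b, x} := by
      intro T hT
      simp only [trianglesAt, Finset.mem_inter, Finset.mem_filter,
        SimpleGraph.mem_cliqueFinset_iff, Finset.mk_mem_sym2_iff] at hT
      symm
      refine Finset.eq_of_subset_of_card_le ?_ ?_
      · intro y hy
        simp only [Finset.mem_insert, Finset.mem_singleton] at hy
        rcases hx with rfl | rfl <;> rcases hy with rfl | rfl | rfl <;> tauto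
      · rw [hT.1.1.card_eq, Finset.card_eq_three.2 ⟨a, b, x, hab, hxa.symm, hxb.symm, rfl⟩]
    exact Finset.card_le_one.2 fun T hT T' hT' => (key T hT).trans (key T' hT').symm

/-- Each added edge brings at least `y` triangles, at most one of them shared with each earlier
edge. -/
theorem card_mul_le_card_biUnion_trianglesAt {n : ℕ} (G : SimpleGraph (Fin n)) {y : ℝ}
    (hy : ∀ u v, u ≠ v → y ≤ (G.commonNeighbors u v).ncard) (F : Finset (Sym2 (Fin n)))
    (hF : (F : Set (Sym2 (Fin n))) ⊆ G.edgeSet) :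
    (F.card : ℝ) * (y - F.card) ≤ (F.biUnion (trianglesAt G)).card := by
  classical
  induction F using Finset.induction with
  | empty => simp
  | insert e F he ih =>
    have heG : e ∈ G.edgeSet := hF (by simp)
    have h1 := ih fun x hx => hF (by simp [Finset.mem_coe.1 hx])
    have h2 : y ≤ (trianglesAt G e).card := by
      induction e with
      | _ u v =>
        have huv : G.Adj u v := heG
        exact (hy u v huv.ne).trans
          (by exact_mod_cast ncard_commonNeighbors_le_card_trianglesAt huv)
    have h3 : (trianglesAt G e ∩ F.biUnion (trianglesAt G)).card ≤ F.card := by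
      rw [Finset.inter_biUnion]
      refine Finset.card_biUnion_le.trans ((Finset.sum_le_card_nsmul _ _ 1 fun e' he' => ?_).trans
        (by simp))
      exact card_trianglesAt_inter_le_one G heG (hF (by simp [he'])) (by rintro rfl; exact he he')
    have h4 := Finset.card_union_add_card_inter (trianglesAt G e) (F.biUnion (trianglesAt G))
    rw [Finset.biUnion_insert, Finset.card_insert_of_notMem he]
    have h3' : ((trianglesAt G e ∩ F.biUnion (trianglesAt G)).card : ℝ) ≤ F.card := by
      exact_mod_cast h3
    have h4' : ((trianglesAt G e ∪ F.biUnion (trianglesAt G)).card : ℝ) +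
        (trianglesAt G e ∩ F.biUnion (trianglesAt G)).card =
        (trianglesAt G e).card + (F.biUnion (trianglesAt G)).card := by exact_mod_cast h4
    push_cast
    nlinarith

open Classical in
theorem step_toOuterMeasure_le {n : ℕ} (G : SimpleGraph (Fin n)) (F : Finset (Sym2 (Fin n))) :
    (step G).toOuterMeasure {G' | (F : Set (Sym2 (Fin n))) ⊆ G'.edgeSet} ≤
      ENNReal.ofReal (1 - (F.biUnion (trianglesAt G)).card / (G.cliqueFinset 3).card) := by
  unfold step
  split_ifs with h
  · rw [PMF.toOuterMeasure_map_apply, PMF.toOuterMeasure_uniformOfFinset_apply]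
    have hsub : F.biUnion (trianglesAt G) ⊆ G.cliqueFinset 3 :=
      Finset.biUnion_subset.2 fun e _ => Finset.filter_subset _ _
    have hpos : 0 < (G.cliqueFinset 3).card := h.card_pos
    have hle : ((G.cliqueFinset 3).filter fun T => T ∈ (fun T : Finset (Fin n) =>
        G.deleteEdges (T.sym2 : Set (Sym2 (Fin n)))) ⁻¹'
        {G' | (F : Set (Sym2 (Fin n))) ⊆ G'.edgeSet}).card ≤
        (G.cliqueFinset 3).card - (F.biUnion (trianglesAt G)).card := by
      rw [← Finset.card_sdiff_of_subset hsub]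
      refine Finset.card_le_card fun T hT => ?_
      simp only [Finset.mem_filter, Set.mem_preimage, Set.mem_ofPred_eq,
        SimpleGraph.edgeSet_deleteEdges] at hT
      simp only [Finset.mem_sdiff, Finset.mem_biUnion, trianglesAt, Finset.mem_filter, not_exists,
        not_and]
      exact ⟨hT.1, fun e he _ heT => (hT.2 he).2 heT⟩
    have hle2 := Finset.card_le_card hsub
    rw [← ENNReal.ofReal_natCast, ← ENNReal.ofReal_natCast,
      ← ENNReal.ofReal_div_of_pos (by exact_mod_cast hpos)]
    refine ENNReal.ofReal_le_ofReal ?_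
    rw [one_sub_div (by exact_mod_cast hpos.ne'), ← Nat.cast_sub hle2]
    gcongr
  -- Without triangles the quotient is `0 / 0 = 0`, so the bound is the trivial one.
  · rw [Finset.not_nonempty_iff_eq_empty.1 h]
    simp only [Finset.card_empty, Nat.cast_zero, div_zero, sub_zero, ENNReal.ofReal_one]
    rw [PMF.toOuterMeasure_pure_apply]
    split_ifs <;> simp

theorem step_toOuterMeasure_eq_zero {n : ℕ} (G : SimpleGraph (Fin n)) (F : Set (Sym2 (Fin n)))
    (hF : ¬ F ⊆ G.edgeSet) :
    (step G).toOuterMeasure {G' | F ⊆ G'.edgeSet} = 0 := by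
  classical
  rw [PMF.toOuterMeasure_apply_eq_zero_iff, Set.disjoint_left]
  intro G' hG' hFG
  unfold step at hG'
  split_ifs at hG' with h
  · rw [PMF.mem_support_map_iff] at hG'
    obtain ⟨T, _, rfl⟩ := hG'
    exact hF (hFG.trans (SimpleGraph.edgeSet_mono (SimpleGraph.deleteEdges_le _)))
  · rw [PMF.mem_support_pure_iff] at hG'
    exact hF (hG' ▸ hFG)

-- The main term is `f n q ^ 2` divided by `n ^ 3 q ^ 3 / 6`. The error `δ` is split in three:
-- codegrees, the number of triangles, and triangles containing several edges of `F`.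
open Classical in
theorem step_toOuterMeasure_le_of_codegree {n : ℕ} (G : SimpleGraph (Fin n))
    (F : Finset (Sym2 (Fin n))) (hF : (F : Set (Sym2 (Fin n))) ⊆ G.edgeSet) {q δ : ℝ}
    (hn : 0 < n) (hq : 0 < q) (hδ0 : 0 < δ) (hδ1 : δ ≤ 1 / 2)
    (hy : ∀ u v, u ≠ v → n * q ^ 2 * (1 - δ / 3) ≤ (G.commonNeighbors u v).ncard)
    (hQ : ((G.cliqueFinset 3).card : ℝ) ≤ 1 / 6 * (n : ℝ) ^ 3 * q ^ 3 * (1 + δ / 3))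
    (hf : (F.card : ℝ) ≤ δ / 3 * (n * q ^ 2)) :
    (step G).toOuterMeasure {G' | (F : Set (Sym2 (Fin n))) ⊆ G'.edgeSet} ≤
      ENNReal.ofReal (1 - F.card * (6 / (n ^ 2 * q)) * (1 - δ)) := by
  refine (step_toOuterMeasure_le G F).trans (ENNReal.ofReal_le_ofReal ?_)
  have hn' : (0 : ℝ) < n := by exact_mod_cast hn
  have hhit := card_mul_le_card_biUnion_trianglesAt G hy F hF
  have hsub : F.biUnion (trianglesAt G) ⊆ G.cliqueFinset 3 :=
    Finset.biUnion_subset.2 fun e _ => Finset.filter_subset _ _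
  have hle2 : ((F.biUnion (trianglesAt G)).card : ℝ) ≤ (G.cliqueFinset 3).card := by
    exact_mod_cast Finset.card_le_card hsub
  set h : ℝ := ((F.biUnion (trianglesAt G)).card : ℝ)
  set Q : ℝ := ((G.cliqueFinset 3).card : ℝ)
  set f : ℝ := (F.card : ℝ)
  have hf0 : 0 ≤ f := Nat.cast_nonneg _
  rcases hf0.eq_or_lt with hf0 | hf0
  · rw [← hf0]
    simp only [zero_mul, sub_zero]
    have : 0 ≤ h / Q := div_nonneg (Nat.cast_nonneg _) (Nat.cast_nonneg _)
    linarith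
  have hnq : 0 < n * q ^ 2 := by positivity
  have h1 : f * (n * q ^ 2 * (1 - 2 * δ / 3)) ≤ h := by
    refine le_trans (mul_le_mul_of_nonneg_left ?_ hf0.le) hhit
    linarith
  have hQ0 : 0 < Q := by
    refine lt_of_lt_of_le (lt_of_lt_of_le ?_ h1) hle2
    have : 0 < 1 - 2 * δ / 3 := by linarith
    positivity
  have : f * (6 / (n ^ 2 * q)) * (1 - δ) ≤ h / Q := by
    rw [le_div_iff₀ hQ0]
    refine le_trans (mul_le_mul_of_nonneg_left hQ ?_) (le_trans ?_ h1)
    · have : 0 < 1 - δ := by linarith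
      positivity
    · have e : f * (6 / (n ^ 2 * q)) * (1 - δ) * (1 / 6 * (n : ℝ) ^ 3 * q ^ 3 * (1 + δ / 3)) =
        f * (n * q ^ 2) * ((1 - δ) * (1 + δ / 3)) := by field_simp
      have e' : (1 - δ) * (1 + δ / 3) ≤ 1 - 2 * δ / 3 := by nlinarith [sq_nonneg δ]
      rw [e, mul_assoc f]
      gcongr
  linarith

/-! ### Survival of a fixed edge set along a controlled trajectory -/

theorem degreeControl_congr {C : ℝ} {n : ℕ} {g g' : ℕ → SimpleGraph (Fin n)} {j : ℕ}
    (h : g j = g' j) : DegreeControl C g j ↔ DegreeControl C g' j := by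
  unfold DegreeControl
  rw [h]

/-- An event that is determined by the first `i` steps has the same probability in all longer
runs. -/
theorem pathLaw_toOuterMeasure_of_le {n i m : ℕ} (him : i ≤ m)
    (E : Set (ℕ → SimpleGraph (Fin n)))
    (hE : ∀ g g', (∀ j ≤ i, g j = g' j) → g ∈ E → g' ∈ E) :
    (pathLaw n m).toOuterMeasure E = (pathLaw n i).toOuterMeasure E := by
  induction m, him using Nat.le_induction with
  | base => rfl
  | succ m him ih =>
    rw [← ih, pathLaw, PMF.toOuterMeasure_bind_apply, PMF.toOuterMeasure_apply]
    refine tsum_congr fun g => ?_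
    rw [PMF.toOuterMeasure_map_apply]
    have hpre : ((fun G' => fun j => if j ≤ m then g j else G') ⁻¹' E) =
        {_G' : SimpleGraph (Fin n) | g ∈ E} := by
      ext G'
      simp only [Set.mem_preimage, Set.mem_ofPred_eq]
      constructor
      · exact hE _ _ fun j hj => if_pos (hj.trans him)
      · exact hE _ _ fun j hj => (if_pos (hj.trans him)).symm
    rw [hpre]
    by_cases hg : g ∈ E
    · simp only [hg, Set.ofPred_true, Set.indicator_of_mem]
      rw [(PMF.toOuterMeasure_apply_eq_one_iff _ _).2 (Set.subset_univ _), mul_one]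
    · simp [hg]

/-- The trajectories with controlled degrees before step `i`. -/
def controlled (C : ℝ) (n i : ℕ) : Set (ℕ → SimpleGraph (Fin n)) :=
  {g | ∀ j, 0 < j → j < i → DegreeControl C g j}

theorem controlled_congr {C : ℝ} {n i : ℕ} {g g' : ℕ → SimpleGraph (Fin n)}
    (h : ∀ j < i, g j = g' j) : g ∈ controlled C n i ↔ g' ∈ controlled C n i :=
  forall_congr' fun j => forall_congr' fun _ => forall_congr' fun hj =>
    degreeControl_congr (h j hj)

/-- Condition on the first `i` steps: they already decide `controlled C n (i + 1)`, and since edges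
never return, `F` must be present in `g i`. -/
theorem pathLaw_succ_toOuterMeasure_le {C : ℝ} {n i : ℕ} (F : Set (Sym2 (Fin n)))
    {c : ENNReal}
    (hstep : ∀ g ∈ (pathLaw n i).support, g ∈ controlled C n (i + 1) → F ⊆ (g i).edgeSet →
      (step (g i)).toOuterMeasure {G' | F ⊆ G'.edgeSet} ≤ c) :
    (pathLaw n (i + 1)).toOuterMeasure
        (controlled C n (i + 1) ∩ {g | F ⊆ (g (i + 1)).edgeSet}) ≤
      (pathLaw n i).toOuterMeasure (controlled C n i ∩ {g | F ⊆ (g i).edgeSet}) * c := by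
  rw [pathLaw, PMF.toOuterMeasure_bind_apply, PMF.toOuterMeasure_apply, ← ENNReal.tsum_mul_right]
  refine ENNReal.tsum_le_tsum fun g => ?_
  by_cases hg : g ∈ (pathLaw n i).support
  swap
  · rw [PMF.mem_support_iff, not_not] at hg
    simp [hg]
  rw [PMF.toOuterMeasure_map_apply]
  by_cases hc : g ∈ controlled C n (i + 1)
  swap
  · have : ((fun G' => fun j => if j ≤ i then g j else G') ⁻¹'
        (controlled C n (i + 1) ∩ {g | F ⊆ (g (i + 1)).edgeSet})) = ∅ := by
      refine Set.eq_empty_of_forall_notMem fun G' hG' => hc ?_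
      exact (controlled_congr fun j hj => if_pos (Nat.lt_succ_iff.1 hj)).1 hG'.1
    simp [this]
  have hsub : ((fun G' => fun j => if j ≤ i then g j else G') ⁻¹'
      (controlled C n (i + 1) ∩ {g | F ⊆ (g (i + 1)).edgeSet})) ⊆ {G' | F ⊆ G'.edgeSet} := by
    intro G' hG'
    have := hG'.2
    simpa using this
  by_cases hF : F ⊆ (g i).edgeSet
  · have hmem : g ∈ controlled C n i ∩ {g | F ⊆ (g i).edgeSet} :=
      ⟨fun j h0 hj => hc j h0 (hj.trans (Nat.lt_succ_self i)), hF⟩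
    rw [Set.indicator_of_mem hmem]
    gcongr
    exact (MeasureTheory.measure_mono hsub).trans (hstep g hg hc hF)
  · have := MeasureTheory.measure_mono (μ := (step (g i)).toOuterMeasure) hsub
    rw [step_toOuterMeasure_eq_zero _ _ hF] at this
    rw [le_antisymm this bot_le, mul_zero]
    exact bot_le

/-- The factor matches the approximate one-step survival probability of a single edge, so that
survival probabilities telescope to powers of `p`. -/
theorem p_succ {n : ℕ} (i : ℕ) (hp : p n i ≠ 0) :
    p n (i + 1) = p n i * (1 - 6 / ((n : ℝ) ^ 2 * p n i)) := by
  rcases Nat.eq_zero_or_pos n with rfl | hn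
  · simp [p]
  have hn' : (n : ℝ) ≠ 0 := by exact_mod_cast hn.ne'
  have : p n (i + 1) = p n i - 6 / (n : ℝ) ^ 2 := by
    unfold p; push_cast; ring
  rw [this]
  field_simp

/-- Uses `log (1 - x) ≥ -x / (1 - x)`. Passing from `δ` to `2 * δ` pays for the denominator, as `x ≤
δ`. -/
theorem one_sub_mul_le_rpow {f x δ : ℝ} (hf : 0 ≤ f) (hx0 : 0 ≤ x) (hxδ : x ≤ δ)
    (hδ : δ ≤ 1 / 2) : 1 - f * x * (1 - δ) ≤ (1 - x) ^ (f * (1 - 2 * δ)) := by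
  have hx : 0 < 1 - x := by linarith
  rw [Real.rpow_def_of_pos hx]
  have h1 := Real.one_sub_inv_le_log_of_pos hx
  have h2 := Real.add_one_le_exp (-(f * x * (1 - δ)))
  refine le_trans (by linarith) (h2.trans (Real.exp_le_exp.2 ?_))
  have h3 : (1 - (1 - x)⁻¹) * (f * (1 - 2 * δ)) ≤ Real.log (1 - x) * (f * (1 - 2 * δ)) :=
    mul_le_mul_of_nonneg_right h1 (mul_nonneg hf (by linarith))
  refine le_trans ?_ h3
  have e : (1 - (1 - x)⁻¹) * (f * (1 - 2 * δ)) = -(f * x * ((1 - 2 * δ) / (1 - x))) := by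
    field_simp; ring
  rw [e, neg_le_neg_iff]
  refine mul_le_mul_of_nonneg_left ?_ (mul_nonneg hf hx0)
  rw [div_le_iff₀ hx]
  nlinarith

/-- Numerical conditions under which the evolution is predictable at step `j`. -/
structure Tame (C δ f : ℝ) (n j : ℕ) : Prop where
  p_pos : 0 < p n j
  zeta_le : C * zeta n j ≤ δ / 3
  zeta_sq_le : C * zeta n j ^ 2 ≤ δ / 3
  card_le : f ≤ δ / 3 * (n * p n j ^ 2)
  decay_le : 6 / ((n : ℝ) ^ 2 * p n j) ≤ δ
  two_le : 2 ≤ δ / 3 * n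

open Classical in
theorem step_toOuterMeasure_le_of_tame {C δ : ℝ} {n i : ℕ} (hn : 0 < n) (hδ0 : 0 < δ)
    (hδ1 : δ ≤ 1 / 2) (F : Finset (Sym2 (Fin n))) (ht : Tame C δ F.card n i)
    (g : ℕ → SimpleGraph (Fin n)) (hg : g ∈ (pathLaw n i).support)
    (hc : g ∈ controlled C n (i + 1)) (hF : (F : Set (Sym2 (Fin n))) ⊆ (g i).edgeSet) :
    (step (g i)).toOuterMeasure {G' | (F : Set (Sym2 (Fin n))) ⊆ G'.edgeSet} ≤
      ENNReal.ofReal (1 - F.card * (6 / (n ^ 2 * p n i)) * (1 - δ)) := by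
  have hn' : (0 : ℝ) < n := by exact_mod_cast hn
  have hp := ht.p_pos
  -- `controlled` says nothing about time `0`, where the complete graph is computed directly.
  rcases Nat.eq_zero_or_pos i with rfl | hi
  · have hg0 : g 0 = ⊤ := by
      rw [pathLaw, PMF.mem_support_pure_iff] at hg
      rw [hg]
    have hp0 : p n 0 = 1 := by simp [p]
    refine step_toOuterMeasure_le_of_codegree (g 0) F hF hn hp hδ0 hδ1 ?_ ?_ ht.card_le
    · intro u v huv
      rw [hg0, Set.ncard_eq_toFinset_card', Set.toFinset_card,
        SimpleGraph.card_commonNeighbors_top huv, hp0, Fintype.card_fin]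
      have h2 := ht.two_le
      have : (n : ℝ) ≤ ((n - 2 : ℕ) : ℝ) + 2 := by exact_mod_cast (by omega : n ≤ n - 2 + 2)
      nlinarith
    · have h1 : ((g 0).cliqueFinset 3).card ≤ n.choose 3 := by
        simpa using (g 0).card_cliqueFinset_le (n := 3)
      have h2 : (n.choose 3 : ℝ) ≤ (n : ℝ) ^ 3 / Nat.factorial 3 := Nat.choose_le_pow_div 3 n
      have h3 : (((g 0).cliqueFinset 3).card : ℝ) ≤ n.choose 3 := by exact_mod_cast h1
      rw [hp0]
      have h4 : (Nat.factorial 3 : ℝ) = 6 := by norm_num [Nat.factorial]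
      rw [h4] at h2
      have : 0 < (n : ℝ) ^ 3 := by positivity
      nlinarith
  · obtain ⟨-, h2, h3⟩ := hc i hi (Nat.lt_succ_self i)
    refine step_toOuterMeasure_le_of_codegree (g i) F hF hn hp hδ0 hδ1 ?_ ?_ ht.card_le
    · intro u v huv
      have h := (abs_lt.1 ((h2 u v huv).trans_le ht.zeta_le)).1
      have hd : 0 < (n : ℝ) * p n i ^ 2 := by positivity
      have : 1 - δ / 3 ≤ (((g i).commonNeighbors u v).ncard : ℝ) / (n * p n i ^ 2) := by linarith
      rw [le_div_iff₀ hd] at this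
      linarith
    · have h := (abs_lt.1 (h3.trans_le ht.zeta_sq_le)).2
      have hd : 0 < 1 / 6 * (n : ℝ) ^ 3 * p n i ^ 3 := by positivity
      have h5 : (((g i).cliqueSet 3).ncard : ℝ) / (1 / 6 * (n : ℝ) ^ 3 * p n i ^ 3) ≤
        1 + δ / 3 := by linarith
      rw [div_le_iff₀ hd, ← SimpleGraph.coe_cliqueFinset, Set.ncard_coe_finset] at h5
      linarith

/-- A fixed set of edges survives a controlled evolution with about the probability that it has in
the binomial random graph. -/
theorem pathLaw_toOuterMeasure_subset_le {C δ : ℝ} {n : ℕ} (hn : 0 < n) (hδ0 : 0 < δ)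
    (hδ1 : δ ≤ 1 / 2) (F : Finset (Sym2 (Fin n))) (i : ℕ)
    (ht : ∀ j < i, Tame C δ F.card n j) :
    0 < p n i ∧ (pathLaw n i).toOuterMeasure
        (controlled C n i ∩ {g | (F : Set (Sym2 (Fin n))) ⊆ (g i).edgeSet}) ≤
      ENNReal.ofReal (p n i ^ ((F.card : ℝ) * (1 - 2 * δ))) := by
  classical
  induction i with
  | zero =>
    have hp0 : p n 0 = 1 := by simp [p]
    refine ⟨by simp [hp0], ?_⟩
    rw [hp0, Real.one_rpow, ENNReal.ofReal_one]
    refine (MeasureTheory.measure_mono (Set.subset_univ _)).trans_eq ?_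
    exact (PMF.toOuterMeasure_apply_eq_one_iff _ _).2 (Set.subset_univ _)
  | succ i ih =>
    obtain ⟨hp, ih⟩ := ih fun j hj => ht j (hj.trans (Nat.lt_succ_self i))
    have hti := ht i (Nat.lt_succ_self i)
    have hn' : (0 : ℝ) < n := by exact_mod_cast hn
    have hx := hti.decay_le
    have h1x : 0 < 1 - 6 / ((n : ℝ) ^ 2 * p n i) := by linarith
    rw [p_succ i hp.ne']
    refine ⟨mul_pos hp h1x, ?_⟩
    refine (pathLaw_succ_toOuterMeasure_le (F : Set (Sym2 (Fin n)))
      (step_toOuterMeasure_le_of_tame hn hδ0 hδ1 F hti)).trans ?_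
    rw [Real.mul_rpow hp.le h1x.le, ENNReal.ofReal_mul (by positivity)]
    gcongr
    exact one_sub_mul_le_rpow (Nat.cast_nonneg _) (by positivity) hx hδ1

-- This lets `G ↦ P(E, g i = G)` serve as the weight in the moment bounds.
open Classical in
theorem sum_toReal_toOuterMeasure_inter_eq {n : ℕ} (P : PMF (ℕ → SimpleGraph (Fin n)))
    (E : Set (ℕ → SimpleGraph (Fin n))) (i : ℕ) (S : Finset (SimpleGraph (Fin n))) :
    ∑ G ∈ S, (P.toOuterMeasure (E ∩ {g | g i = G})).toReal =
      (P.toOuterMeasure (E ∩ {g | g i ∈ S})).toReal := by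
  have hfin : ∀ A, P.toOuterMeasure A ≠ ⊤ := fun A => by
    refine ne_top_of_le_ne_top ENNReal.one_ne_top
      ((MeasureTheory.measure_mono (Set.subset_univ A)).trans_eq ?_)
    exact (PMF.toOuterMeasure_apply_eq_one_iff _ _).2 (Set.subset_univ _)
  rw [← ENNReal.toReal_sum fun G _ => hfin _]
  congr 1
  simp only [PMF.toOuterMeasure_apply]
  rw [← Summable.tsum_finsetSum fun _ _ => ENNReal.summable]
  refine tsum_congr fun g => ?_
  simp only [Set.indicator_apply, Set.mem_inter_iff, Set.mem_ofPred_eq]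
  by_cases hE : g ∈ E <;> simp [hE]

/-! ### Numerical estimates before `τ⋆` -/

/-- The lower bound on `p` that holds before `τ⋆`. -/
def Dense (n j : ℕ) : Prop := Real.log n ^ 8 ≤ n * p n j ^ 2 ∧ 0 < p n j

theorem p_le_one (n i : ℕ) : p n i ≤ 1 := by
  unfold p
  have : 0 ≤ 6 * (i : ℝ) / (n : ℝ) ^ 2 := by positivity
  linarith

theorem zeta_pow_mul_le {n j : ℕ} (hn : 0 < n) (hl : 0 < Real.log n) (h : Dense n j) :
    0 < zeta n j ∧ zeta n j * Real.log n ^ 3 ≤ 1 := by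
  obtain ⟨h, hp⟩ := h
  have hn' : (0 : ℝ) < n := by exact_mod_cast hn
  have e : zeta n j = Real.log n / (Real.sqrt n * p n j) := by
    unfold zeta
    rw [Real.rpow_neg hn'.le, ← Real.sqrt_eq_rpow]
    field_simp
  have hs : 0 < Real.sqrt n * p n j := mul_pos (Real.sqrt_pos.2 hn') hp
  refine ⟨by rw [e]; positivity, ?_⟩
  rw [e, div_mul_eq_mul_div, div_le_one hs]
  refine (pow_le_pow_iff_left₀ (by positivity) hs.le two_ne_zero).1 ?_
  rw [mul_pow _ (p n j), Real.sq_sqrt hn'.le]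
  calc _ = Real.log n ^ 8 := by ring
    _ ≤ _ := h

/-- With `w ≥ 3` the logarithmic bound gives `ζ ≤ (log n) ^ (-3)`, which rearranges to the claim. As
`Real.log` is even, it does not exclude `ζ < 0`; positivity comes from the degree control, where `C
ζ` exceeds an absolute value. -/
theorem dense_of_control {C w : ℝ} (hC : 0 < C) {n j : ℕ} (hn : 0 < n)
    (hl : 1 < Real.log n) (hw : 3 ≤ w) {g : ℕ → SimpleGraph (Fin n)}
    (hc : DegreeControl C g j) (h : w ≤ Real.log (1 / zeta n j) / Real.log (Real.log n)) :
    Dense n j := by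
  have hn' : (0 : ℝ) < n := by exact_mod_cast hn
  have hl0 : 0 < Real.log n := by linarith
  have hz : 0 < zeta n j := by
    have := (abs_nonneg _).trans_lt (hc.1 ⟨0, hn⟩)
    exact pos_of_mul_pos_right this hC.le
  have e : zeta n j = Real.log n / (Real.sqrt n * p n j) := by
    unfold zeta
    rw [Real.rpow_neg hn'.le, ← Real.sqrt_eq_rpow, div_eq_mul_inv, mul_inv]
    ring
  have hs0 : 0 < Real.sqrt n * p n j := by
    rw [e] at hz
    by_contra hcon
    exact absurd hz (not_lt.2 (div_nonpos_of_nonneg_of_nonpos hl0.le (not_lt.1 hcon)))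
  have hp : 0 < p n j := pos_of_mul_pos_right hs0 (Real.sqrt_nonneg _)
  refine ⟨?_, hp⟩
  have hll : 0 < Real.log (Real.log n) := Real.log_pos hl
  have h3 : Real.log (Real.log n ^ 3) ≤ Real.log (1 / zeta n j) := by
    rw [le_div_iff₀ hll] at h
    rw [Real.log_pow]
    push_cast
    nlinarith
  rw [Real.log_le_log_iff (by positivity) (by positivity), e, one_div_div,
    le_div_iff₀ hl0, ← pow_succ] at h3
  calc Real.log n ^ 8 = (Real.log n ^ 4) ^ 2 := by ring
    _ ≤ (Real.sqrt n * p n j) ^ 2 := by gcongr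
    _ = _ := by rw [mul_pow, Real.sq_sqrt hn'.le]

/-- The choice `δ = 1 / log n` is small enough that `p ^ (-2 δ)` stays bounded for `p ≥ 1 / n`, and
large enough to dominate `ζ` and `f / (n p ^ 2)` for `f = O(log n)`. -/
theorem tame_of_dense {C K f : ℝ} (hC : 0 < C) (hK : 0 ≤ K) {n j : ℕ} (hn : 0 < n)
    (hl : 6 * K + 3 * C + 6 ≤ Real.log n) (hf : f ≤ K * (Real.log n + 1)) (h : Dense n j) :
    Tame C (1 / Real.log n) f n j := by
  have hn' : (1 : ℝ) ≤ n := by exact_mod_cast hn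
  set l := Real.log n with hldef
  have hl6 : 6 ≤ l := by linarith
  have hl0 : 0 < l := by linarith
  obtain ⟨hz0, hz⟩ := zeta_pow_mul_le hn hl0 h
  obtain ⟨h8, hp⟩ := h
  have hp1 := p_le_one n j
  rw [← hldef] at h8 hz
  have hl2 : l ^ 2 ≤ l ^ 7 := pow_le_pow_right₀ (by linarith) (by norm_num)
  have hCz : C * zeta n j ≤ 1 / l / 3 := by
    have h1 : 3 * C ≤ l ^ 2 := by nlinarith
    have h2 : zeta n j * l ^ 3 * (3 * C) ≤ l ^ 2 := by
      calc _ ≤ 1 * (3 * C) := by gcongr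
        _ ≤ l ^ 2 := by linarith
    rw [div_div, le_div_iff₀ (by positivity)]
    have h3 : (C * zeta n j * (l * 3)) * l ^ 2 ≤ 1 * l ^ 2 := by
      calc _ = zeta n j * l ^ 3 * (3 * C) := by ring
        _ ≤ 1 * l ^ 2 := by linarith
    exact le_of_mul_le_mul_right h3 (by positivity)
  have hnp : (n : ℝ) * p n j ^ 2 ≤ n := by
    have : p n j ^ 2 ≤ 1 := pow_le_one₀ hp.le hp1
    nlinarith
  have hl7 : 6 * l ≤ l ^ 8 := by
    have : 6 ≤ l ^ 7 := by nlinarith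
    calc 6 * l ≤ l ^ 7 * l := by gcongr
      _ = l ^ 8 := by ring
  refine ⟨hp, hCz, ?_, ?_, ?_, ?_⟩
  · refine le_trans ?_ hCz
    have h1 : 1 ≤ l ^ 3 := one_le_pow₀ (by linarith)
    have : zeta n j ≤ 1 := by nlinarith
    have : zeta n j ^ 2 ≤ zeta n j := by nlinarith
    gcongr
  · refine hf.trans ?_
    have h1 : K * (l + 1) ≤ l ^ 2 / 3 := by nlinarith
    refine h1.trans ?_
    calc l ^ 2 / 3 ≤ l ^ 7 / 3 := by gcongr
      _ = 1 / l / 3 * l ^ 8 := by field_simp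
      _ ≤ _ := by gcongr
  · rw [div_le_div_iff₀ (by positivity) hl0, one_mul]
    refine hl7.trans (h8.trans ?_)
    have h1 : p n j ^ 2 ≤ p n j := by nlinarith
    have h2 : (n : ℝ) ≤ (n : ℝ) ^ 2 := by nlinarith
    exact mul_le_mul h2 h1 (by positivity) (by positivity)
  · have : 6 * l ≤ n := hl7.trans (h8.trans hnp)
    calc (2 : ℝ) = 1 / l / 3 * (6 * l) := by field_simp; norm_num
      _ ≤ _ := by gcongr

theorem pathLaw_toOuterMeasure_subset_le_pow {C K : ℝ} (hC : 0 < C) (hK : 0 ≤ K) {n i : ℕ}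
    (hn : 0 < n) (hl : 6 * K + 3 * C + 6 ≤ Real.log n) (h : ∀ j < i, Dense n j)
    (F : Finset (Sym2 (Fin n))) (hF : (F.card : ℝ) ≤ K * (Real.log n + 1)) :
    0 < p n i ∧ (pathLaw n i).toOuterMeasure
        (controlled C n i ∩ {g | (F : Set (Sym2 (Fin n))) ⊆ (g i).edgeSet}) ≤
      ENNReal.ofReal ((Real.exp 2 * p n i) ^ F.card) := by
  have hl6 : 6 ≤ Real.log n := by linarith
  have hl0 : 0 < Real.log n := by linarith
  have hn' : (0 : ℝ) < n := by exact_mod_cast hn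
  have hδ1 : 1 / Real.log n ≤ 1 / 2 := by gcongr; linarith
  have ht : ∀ j < i, Tame C (1 / Real.log n) F.card n j := fun j hj =>
    tame_of_dense hC hK hn hl hF (h j hj)
  obtain ⟨hp, hP⟩ := pathLaw_toOuterMeasure_subset_le hn (by positivity) hδ1 F i ht
  refine ⟨hp, hP.trans (ENNReal.ofReal_le_ofReal ?_)⟩
  -- This is `p ≥ 1 / n`, whence `p ^ (-2 / log n) ≤ e ^ 2`. Density is known only before `i`, but
  -- the last step at most halves `p`.
  have hlog : -Real.log n ≤ Real.log (p n i) := by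
    rw [← Real.log_inv]
    refine Real.log_le_log (by positivity) ?_
    rcases Nat.eq_zero_or_pos i with rfl | hi
    · simp only [p, Nat.cast_zero, mul_zero, zero_div, sub_zero]
      exact inv_le_one_of_one_le₀ (by exact_mod_cast hn)
    · obtain ⟨j, rfl⟩ : ∃ j, i = j + 1 := ⟨i - 1, by omega⟩
      have htj := ht j (Nat.lt_succ_self j)
      obtain ⟨h8, hpj⟩ := h j (Nat.lt_succ_self j)
      rw [p_succ j hpj.ne']
      have h1 : (1 : ℝ) / 2 ≤ 1 - 6 / ((n : ℝ) ^ 2 * p n j) := by linarith [htj.decay_le]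
      have hpj1 := p_le_one n j
      have h2 : 2 ≤ n * p n j := by
        have h3 : (6 : ℝ) ≤ Real.log n ^ 8 :=
          hl6.trans (le_self_pow₀ (by linarith) (by norm_num))
        have h4 : n * p n j ^ 2 ≤ n * p n j := by
          have : p n j ^ 2 ≤ p n j := by nlinarith
          gcongr
        linarith
      rw [inv_le_iff_one_le_mul₀ hn']
      nlinarith
  rw [← Real.rpow_natCast (Real.exp 2 * p n i), Real.mul_rpow (Real.exp_pos _).le hp.le,
    ← Real.exp_mul, Real.rpow_def_of_pos hp, Real.rpow_def_of_pos hp, ← Real.exp_add]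
  refine Real.exp_le_exp.2 ?_
  have h1 : -(1 / Real.log n * Real.log (p n i)) ≤ 1 := by
    rw [← neg_le_neg_iff, neg_neg, one_div, inv_mul_eq_div, le_div_iff₀ hl0]
    linarith
  have hF0 : (0 : ℝ) ≤ F.card := Nat.cast_nonneg _
  nlinarith

/-! ### Tail bound at a fixed time and union bound -/

-- Markov's inequality with `r = ⌈log n⌉`. The extra factor `log n` in the threshold beats all
-- constants, so the base of the `r`-th power is at most `exp (-(|V| + 4))`.
open Classical in
theorem pathLaw_toOuterMeasure_lt_card_copies_le {V : Type*} [Fintype V] (H : SimpleGraph V)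
    (R : Finset V) {C : ℝ} (hC : 0 < C) {n i : ℕ} (hn : 0 < n)
    (hl : 6 * (H.edgeFinset.card : ℝ) + 3 * C + 6 ≤ Real.log n)
    (hl2 : Real.exp 2 ^ H.edgeFinset.card * 2 ^ Fintype.card V *
      (2 * Fintype.card V + 1) ^ (Fintype.card V - R.card) *
      Real.exp (Fintype.card V + 4) ≤ Real.log n)
    (h : ∀ j < i, Dense n j) (φ : V → Fin n) {B : ℝ}
    (hB : ∀ K : Finset V, R ⊆ K →
      (n : ℝ) ^ (Fintype.card V - K.card) * p n i ^ (outerEdges H K).card ≤ B) (hB0 : 0 < B) :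
    (pathLaw n i).toOuterMeasure (controlled C n i ∩
      {g | B * Real.log n ^ (Fintype.card V - R.card + 1) < (copies H R φ (g i)).card}) ≤
      ENNReal.ofReal (((n : ℝ) ^ (Fintype.card V + 4))⁻¹) := by
  set l := Real.log n with hldef
  have hK0 : (0 : ℝ) ≤ H.edgeFinset.card := Nat.cast_nonneg _
  have hl6 : 6 ≤ l := by linarith
  have hl0 : 0 < l := by linarith
  have hn' : (0 : ℝ) < n := by exact_mod_cast hn
  have hr1 : l ≤ ⌈l⌉₊ := Nat.le_ceil l
  have hr2 : (⌈l⌉₊ : ℝ) ≤ l + 1 := (Nat.ceil_lt_add_one hl0.le).le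
  set r := ⌈l⌉₊
  have hp : 0 < p n i :=
    (pathLaw_toOuterMeasure_subset_le_pow hC hK0 hn hl h ∅ (by simp; positivity)).1
  have key := sum_filter_lt_card_copies_le H R φ
    (fun G => ((pathLaw n i).toOuterMeasure (controlled C n i ∩ {g | g i = G})).toReal)
    (fun G => ENNReal.toReal_nonneg) (r := r) (m := r * Fintype.card V + 1)
    (Nat.le_add_left 1 _) (M := Real.exp 2) (p := p n i) (B := B)
    (Real.one_le_exp (by norm_num)) hp.le (p_le_one n i) ?_ hB hB0 (Nat.le_succ _)
    (l := l ^ (Fintype.card V - R.card + 1)) (by positivity)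
  · rw [sum_toReal_toOuterMeasure_inter_eq] at key
    simp only [Finset.mem_filter, Finset.mem_univ, true_and] at key
    refine (ENNReal.le_ofReal_iff_toReal_le ?_ (by positivity)).2 (key.trans ?_)
    · refine ne_top_of_le_ne_top ENNReal.one_ne_top
        ((MeasureTheory.measure_mono (Set.subset_univ _)).trans_eq ?_)
      exact (PMF.toOuterMeasure_apply_eq_one_iff _ _).2 (Set.subset_univ _)
    · have hm : ((r * Fintype.card V + 1 : ℕ) : ℝ) ≤ l * (2 * Fintype.card V + 1) := by
        push_cast
        have h0 : (0 : ℝ) ≤ Fintype.card V := Nat.cast_nonneg _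
        nlinarith
      have hbase : Real.exp 2 ^ H.edgeFinset.card * 2 ^ Fintype.card V *
          ((r * Fintype.card V + 1 : ℕ) : ℝ) ^ (Fintype.card V - R.card) /
          l ^ (Fintype.card V - R.card + 1) ≤ Real.exp (-(Fintype.card V + 4)) := by
        rw [div_le_iff₀ (by positivity)]
        calc _ ≤ Real.exp 2 ^ H.edgeFinset.card * 2 ^ Fintype.card V *
              (l * (2 * Fintype.card V + 1)) ^ (Fintype.card V - R.card) := by gcongr
          _ = Real.exp (-(Fintype.card V + 4)) * ((Real.exp 2 ^ H.edgeFinset.card *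
              2 ^ Fintype.card V * (2 * Fintype.card V + 1) ^ (Fintype.card V - R.card) *
              Real.exp (Fintype.card V + 4)) * l ^ (Fintype.card V - R.card)) := by
                rw [Real.exp_neg, mul_pow]
                field_simp
          _ ≤ Real.exp (-(Fintype.card V + 4)) * (l * l ^ (Fintype.card V - R.card)) := by
                gcongr
          _ = _ := by ring
      refine (pow_le_pow_left₀ (by positivity) hbase r).trans ?_
      rw [← Real.exp_nat_mul, ← Real.exp_log hn', ← Real.exp_nat_mul, ← Real.exp_neg,
        ← hldef]
      refine Real.exp_le_exp.2 ?_
      push_cast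
      have h0 : (0 : ℝ) ≤ Fintype.card V := Nat.cast_nonneg _
      nlinarith
  · intro U hU
    rw [← Finset.sum_filter, sum_toReal_toOuterMeasure_inter_eq]
    simp only [Finset.mem_filter, Finset.mem_univ, true_and]
    refine ENNReal.toReal_le_of_le_ofReal (by positivity)
      (pathLaw_toOuterMeasure_subset_le_pow hC hK0 hn hl h U ?_).2
    have : (U.card : ℝ) ≤ r * H.edgeFinset.card := by exact_mod_cast hU
    refine this.trans ?_
    rw [mul_comm]
    gcongr

/-- The controls may fail at `τ⋆` itself, so only times before `i` are covered; this suffices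
because `g i` arises from steps taken at those times. -/
theorem mem_controlled_of_le_tauStar {C w : ℝ} (hC : 0 < C) {n i : ℕ} (hn : 0 < n)
    (hl : 1 < Real.log n) (hln : Real.log n ^ 8 ≤ n) (hw : 3 ≤ w)
    {g : ℕ → SimpleGraph (Fin n)} (hi : i ≤ tauStar C w g) :
    g ∈ controlled C n i ∧ ∀ j < i, Dense n j := by
  have hnot : ∀ j, 0 < j → j < i →
      DegreeControl C g j ∧ w ≤ Real.log (1 / zeta n j) / Real.log (Real.log n) := by
    intro j h0 hj
    have := Nat.notMem_of_lt_sInf (hj.trans_le hi)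
    by_contra hcon
    exact this ⟨h0, hcon⟩
  refine ⟨fun j h0 hj => (hnot j h0 hj).1, fun j hj => ?_⟩
  rcases Nat.eq_zero_or_pos j with rfl | h0
  · simpa [Dense, p] using hln
  · exact dense_of_control hC hn hl hw (hnot j h0 hj).1 (hnot j h0 hj).2

/-- At step `n ^ 2` the formula gives `p = 1 - 6 < 0`. Hence the union bound runs over at most `n ^
2 + 1` times. -/
theorem le_sq_of_dense {n i : ℕ} (hn : 0 < n) (h : ∀ j < i, Dense n j) : i ≤ n ^ 2 := by
  by_contra hcon
  have hp := (h (n ^ 2) (not_le.1 hcon)).2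
  have hn' : (0 : ℝ) < n := by exact_mod_cast hn
  have : p n (n ^ 2) = -5 := by
    unfold p; push_cast; field_simp; norm_num
  linarith

theorem eventually_log_pow_le : ∀ᶠ n : ℕ in atTop, Real.log n ^ 8 ≤ n := by
  have := (Real.isLittleO_pow_log_id_atTop (n := 8)).bound (zero_lt_one' ℝ)
  filter_upwards [tendsto_natCast_atTop_atTop.eventually this] with n hn
  simpa using (le_abs_self _).trans hn

open Classical in
theorem tendsto_removalLaw_lt_card_copies {V : Type*} [Fintype V] (H : SimpleGraph V)
    (R : Finset V) {C : ℝ} (hC : 0 < C) {ω : ℕ → ℝ} (hω : Tendsto ω atTop atTop)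
    (B : ℕ → ℕ → ℝ) :
    Tendsto (fun n : ℕ => (removalLaw n).toOuterMeasure
      {g | ∃ i ≤ tauStar C (ω n) g, ∃ φ : V → Fin n,
        (∀ K : Finset V, R ⊆ K →
          (n : ℝ) ^ (Fintype.card V - K.card) * p n i ^ (outerEdges H K).card ≤ B n i) ∧
        B n i * Real.log n ^ (Fintype.card V - R.card + 1) < (copies H R φ (g i)).card})
      atTop (𝓝 0) := by
  have hlim : Tendsto (fun n : ℕ => ENNReal.ofReal (2 / n)) atTop (𝓝 0) := by
    have := ENNReal.tendsto_ofReal (tendsto_const_div_atTop_nhds_zero_nat (2 : ℝ))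
    simpa using this
  refine tendsto_of_tendsto_of_tendsto_of_le_of_le' tendsto_const_nhds hlim
    (Eventually.of_forall fun _ => bot_le) ?_
  have hlog : Tendsto (fun n : ℕ => Real.log n) atTop atTop :=
    Real.tendsto_log_atTop.comp tendsto_natCast_atTop_atTop
  filter_upwards [hlog.eventually_ge_atTop (6 * (H.edgeFinset.card : ℝ) + 3 * C + 6),
    hlog.eventually_ge_atTop (Real.exp 2 ^ H.edgeFinset.card * 2 ^ Fintype.card V *
      (2 * Fintype.card V + 1) ^ (Fintype.card V - R.card) * Real.exp (Fintype.card V + 4)),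
    eventually_log_pow_le, hω.eventually_ge_atTop 3, eventually_gt_atTop 0] with n hl hl2 h8 hw hn
  have hn1 : (1 : ℝ) ≤ n := by exact_mod_cast hn
  have hl1 : 1 < Real.log n := by
    have : (0 : ℝ) ≤ H.edgeFinset.card := Nat.cast_nonneg _
    linarith
  -- Density and the condition on `B` do not depend on the trajectory, so the event is empty when
  -- they fail.
  set A : ℕ × (V → Fin n) → Set (ℕ → SimpleGraph (Fin n)) := fun x =>
    if (∀ j < x.1, Dense n j) ∧ ∀ K : Finset V, R ⊆ K →
      (n : ℝ) ^ (Fintype.card V - K.card) * p n x.1 ^ (outerEdges H K).card ≤ B n x.1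
    then controlled C n x.1 ∩ {g | B n x.1 * Real.log n ^ (Fintype.card V - R.card + 1) <
      (copies H R x.2 (g x.1)).card} else ∅ with hA
  have hsub : {g | ∃ i ≤ tauStar C (ω n) g, ∃ φ : V → Fin n,
        (∀ K : Finset V, R ⊆ K →
          (n : ℝ) ^ (Fintype.card V - K.card) * p n i ^ (outerEdges H K).card ≤ B n i) ∧
        B n i * Real.log n ^ (Fintype.card V - R.card + 1) < (copies H R φ (g i)).card} ⊆
      ⋃ x ∈ Finset.range (n ^ 2 + 1) ×ˢ (Finset.univ : Finset (V → Fin n)), A x := by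
    rintro g ⟨i, hi, φ, hB, hlt⟩
    obtain ⟨hc, hd⟩ := mem_controlled_of_le_tauStar hC hn hl1 h8 hw hi
    refine Set.mem_biUnion (x := (i, φ)) ?_ ?_
    · simpa [Nat.lt_succ_iff] using le_sq_of_dense hn hd
    · simp only [hA]
      rw [if_pos ⟨hd, hB⟩]
      exact ⟨hc, hlt⟩
  have hAx : ∀ x ∈ Finset.range (n ^ 2 + 1) ×ˢ (Finset.univ : Finset (V → Fin n)),
      (removalLaw n).toOuterMeasure (A x) ≤
        ENNReal.ofReal (((n : ℝ) ^ (Fintype.card V + 4))⁻¹) := by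
    rintro ⟨i, φ⟩ hx
    simp only [hA]
    split_ifs with hcond
    · have hi : i ≤ n ^ 2 := by simpa [Nat.lt_succ_iff] using hx
      rw [removalLaw, pathLaw_toOuterMeasure_of_le hi]
      -- The choice `K = V` in the condition on `B` gives `1 ≤ B`.
      · have hB1 : 1 ≤ B n i := by
          have := hcond.2 Finset.univ (Finset.subset_univ _)
          simpa [outerEdges] using this
        exact pathLaw_toOuterMeasure_lt_card_copies_le H R hC hn hl hl2 hcond.1 φ hcond.2
          (by linarith)
      · rintro g g' hg ⟨h1, h2⟩
        refine ⟨(controlled_congr fun j hj => hg j hj.le).1 h1, ?_⟩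
        simpa only [Set.mem_ofPred_eq, hg i le_rfl] using h2
    · simp
  refine (MeasureTheory.measure_mono hsub).trans
    ((MeasureTheory.measure_biUnion_finset_le _ _).trans
      ((Finset.sum_le_card_nsmul _ _ _ hAx).trans ?_))
  rw [nsmul_eq_mul, ← ENNReal.ofReal_natCast, ← ENNReal.ofReal_mul (Nat.cast_nonneg _)]
  refine ENNReal.ofReal_le_ofReal ?_
  rw [Finset.card_product, Finset.card_range, Finset.card_univ, Fintype.card_fun,
    Fintype.card_fin, ← div_eq_mul_inv, div_le_div_iff₀ (by positivity) (by positivity)]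
  push_cast
  have h1 : (n : ℝ) ^ 2 + 1 ≤ 2 * n ^ 2 := by nlinarith
  have h2 : (n : ℝ) ^ 3 ≤ (n : ℝ) ^ 4 := pow_le_pow_right₀ hn1 (by norm_num)
  calc ((n : ℝ) ^ 2 + 1) * (n : ℝ) ^ Fintype.card V * (n : ℝ) ≤
        2 * (n : ℝ) ^ 2 * (n : ℝ) ^ Fintype.card V * (n : ℝ) := by gcongr
    _ = 2 * (n : ℝ) ^ Fintype.card V * (n : ℝ) ^ 3 := by ring
    _ ≤ 2 * (n : ℝ) ^ Fintype.card V * (n : ℝ) ^ 4 := by gcongr 2 * (n : ℝ) ^ Fintype.card V * ?_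
    _ = _ := by ring

/-! ### Translation to extension graphs -/

theorem mem_outerEdges {V : Type*} [Fintype V] {H : SimpleGraph V} {K : Finset V} {x y : V} :
    s(x, y) ∈ outerEdges H K ↔ H.Adj x y ∧ ¬ (x ∈ K ∧ y ∈ K) := by
  simp [outerEdges]

namespace RootedGraph

/-- An enumeration of the vertices of `H`. -/
def label (H : RootedGraph ℕ) : Fin H.v ↪ ℕ :=
  (H.verts.equivFin.symm.toEmbedding).trans (Function.Embedding.subtype _)

theorem label_mem (H : RootedGraph ℕ) (x : Fin H.v) : H.label x ∈ H.verts :=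
  (H.verts.equivFin.symm x).2

theorem exists_label_eq (H : RootedGraph ℕ) {a : ℕ} (ha : a ∈ H.verts) : ∃ x, H.label x = a :=
  ⟨H.verts.equivFin ⟨a, ha⟩, congrArg Subtype.val (H.verts.equivFin.symm_apply_apply ⟨a, ha⟩)⟩

/-- The graph of `H`, relabelled. -/
def relabel (H : RootedGraph ℕ) : SimpleGraph (Fin H.v) := H.graph.comap H.label

/-- The distinguished vertices of `H`, relabelled. -/
def relabelRoots (H : RootedGraph ℕ) : Finset (Fin H.v) :=
  Finset.univ.filter fun x => H.label x ∈ H.roots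

theorem map_relabelRoots (H : RootedGraph ℕ) : H.relabelRoots.map H.label = H.roots := by
  ext a
  simp only [Finset.mem_map, relabelRoots, Finset.mem_filter, Finset.mem_univ, true_and]
  constructor
  · rintro ⟨x, hx, rfl⟩; exact hx
  · intro ha
    obtain ⟨x, rfl⟩ := H.exists_label_eq (H.roots_subset ha)
    exact ⟨x, ha, rfl⟩

theorem card_relabelRoots (H : RootedGraph ℕ) : H.relabelRoots.card = H.iota := by
  rw [iota, ← H.map_relabelRoots, Finset.card_map]

/-- The subextension of `H` spanned by the vertices with labels in `K`. -/
def span (H : RootedGraph ℕ) (K : Finset (Fin H.v)) (hK : H.relabelRoots ⊆ K) :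
    RootedGraph ℕ where
  verts := K.map H.label
  graph :=
    { Adj := fun a b => H.graph.Adj a b ∧ a ∈ K.map H.label ∧ b ∈ K.map H.label
      symm := ⟨fun _ _ h => ⟨h.1.symm, h.2.2, h.2.1⟩⟩
      loopless := ⟨fun _ h => h.1.ne rfl⟩ }
  roots := H.roots
  mem_of_adj := fun _ _ h => h.2.1
  roots_subset := by
    rw [← H.map_relabelRoots]
    exact Finset.map_subset_map.2 hK

theorem span_isSubextension (H : RootedGraph ℕ) (K : Finset (Fin H.v))
    (hK : H.relabelRoots ⊆ K) : (H.span K hK).IsSubextension H where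
  verts_subset := by
    intro a ha
    obtain ⟨x, _, rfl⟩ := Finset.mem_map.1 ha
    exact H.label_mem x
  graph_le := fun _ _ h => h.1
  roots_eq := rfl

theorem edgeSet_eq_image (H : RootedGraph ℕ) :
    H.graph.edgeSet = Sym2.map H.label '' H.relabel.edgeSet := by
  ext e
  constructor
  · induction e with
    | _ a b =>
      intro h
      have h' : H.graph.Adj a b := h
      obtain ⟨x, rfl⟩ := H.exists_label_eq (H.mem_of_adj h')
      obtain ⟨y, rfl⟩ := H.exists_label_eq (H.mem_of_adj h'.symm)
      exact ⟨s(x, y), h', rfl⟩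
  · rintro ⟨e', h, rfl⟩
    induction e' with
    | _ x y => exact h

open Classical in
theorem e_eq_card (H : RootedGraph ℕ) : H.e = H.relabel.edgeFinset.card := by
  rw [e, edgeSet_eq_image, Set.ncard_image_of_injective _ (Sym2.map.injective H.label.injective),
    ← SimpleGraph.coe_edgeFinset, Set.ncard_coe_finset]

theorem edgeSet_sdiff_span (H : RootedGraph ℕ) (K : Finset (Fin H.v))
    (hK : H.relabelRoots ⊆ K) : (H.graph \ (H.span K hK).graph).edgeSet =
      Sym2.map H.label '' (outerEdges H.relabel K : Set (Sym2 (Fin H.v))) := by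
  classical
  ext e
  constructor
  · induction e with
    | _ a b =>
      intro h
      have h' : H.graph.Adj a b ∧ ¬ (H.graph.Adj a b ∧ a ∈ K.map H.label ∧ b ∈ K.map H.label) := h
      obtain ⟨x, rfl⟩ := H.exists_label_eq (H.mem_of_adj h'.1)
      obtain ⟨y, rfl⟩ := H.exists_label_eq (H.mem_of_adj h'.1.symm)
      refine ⟨s(x, y), ?_, rfl⟩
      have := h'.2
      simp only [h'.1, true_and, Finset.mem_map'] at this
      exact mem_outerEdges.2 ⟨h'.1, this⟩
  · rintro ⟨e', h, rfl⟩
    induction e' with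
    | _ x y =>
      have h := mem_outerEdges.1 h
      change H.graph.Adj _ _ ∧ ¬ (H.graph.Adj _ _ ∧ _ ∈ K.map H.label ∧ _ ∈ K.map H.label)
      refine ⟨h.1, fun h' => h.2 ?_⟩
      exact ⟨(Finset.mem_map' _).1 h'.2.1, (Finset.mem_map' _).1 h'.2.2⟩

theorem e_quotient_span (H : RootedGraph ℕ) (K : Finset (Fin H.v)) (hK : H.relabelRoots ⊆ K) :
    (H.quotient _ (H.span_isSubextension K hK)).e = (outerEdges H.relabel K).card := by
  change (H.graph \ (H.span K hK).graph).edgeSet.ncard = _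
  rw [edgeSet_sdiff_span, Set.ncard_image_of_injective _ (Sym2.map.injective H.label.injective),
    Set.ncard_coe_finset]

theorem e_span_add (H : RootedGraph ℕ) (K : Finset (Fin H.v)) (hK : H.relabelRoots ⊆ K) :
    (outerEdges H.relabel K).card + (H.span K hK).e = H.e := by
  rw [← e_quotient_span H K hK]
  change (H.graph \ (H.span K hK).graph).edgeSet.ncard + _ = _
  rw [SimpleGraph.edgeSet_sdiff]
  refine Set.ncard_sdiff_add_ncard_of_subset
    (SimpleGraph.edgeSet_mono (H.span_isSubextension K hK).graph_le) ?_
  rw [edgeSet_eq_image]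
  exact Set.toFinite _

theorem v_span (H : RootedGraph ℕ) (K : Finset (Fin H.v)) (hK : H.relabelRoots ⊆ K) :
    (H.span K hK).v = K.card := Finset.card_map _

theorem Psi_le_card_copies (H : RootedGraph ℕ) {n : ℕ} (hn : 0 < n) (φ : H.roots ↪ Fin n) :
    ∃ φ' : Fin H.v → Fin n, ∀ G : SimpleGraph (Fin n),
      H.Psi G φ ≤ (copies H.relabel H.relabelRoots φ' G).card := by
  classical
  -- The value off the roots is irrelevant, since `copies` only consults the map on `relabelRoots`.
  refine ⟨fun x => if h : H.label x ∈ H.roots then φ ⟨_, h⟩ else ⟨0, hn⟩, fun G => ?_⟩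
  rw [← Fintype.card_coe, ← Nat.card_eq_fintype_card, Psi]
  refine Nat.card_le_card_of_injective
    (fun ψ => ⟨fun x => ψ.1 ⟨H.label x, H.label_mem x⟩, ?_⟩) ?_
  · simp only [copies, extensions, Finset.mem_filter, Finset.mem_univ, true_and]
    refine ⟨⟨?_, ?_⟩, ?_⟩
    · intro x y hxy
      exact H.label.injective (congrArg Subtype.val (ψ.1.injective hxy))
    · intro x hx
      have hx' : H.label x ∈ H.roots := by simpa [relabelRoots] using hx
      simpa [hx'] using ψ.2.1 ⟨H.label x, hx'⟩
    · intro a b hab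
      exact ψ.2.2 ⟨_, H.label_mem a⟩ ⟨_, H.label_mem b⟩ hab
  · intro ψ ψ' h
    refine Subtype.ext (DFunLike.ext _ _ fun ⟨a, ha⟩ => ?_)
    obtain ⟨x, rfl⟩ := H.exists_label_eq ha
    exact congrFun (congrArg Subtype.val h) x

/-- For the induced subextension on `K`, `S_H = S_{H/K} S_K` and `S_K ≥ 1`. -/
theorem outer_scaling_le_scaling (H : RootedGraph ℕ) {n : ℕ} {p : ℝ} (hp : 0 ≤ p)
    (h : ∀ K : RootedGraph ℕ, K.IsSubextension H → 1 ≤ K.scaling n p)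
    (K : Finset (Fin H.v)) (hK : H.relabelRoots ⊆ K) :
    (n : ℝ) ^ (H.v - K.card) * p ^ (outerEdges H.relabel K).card ≤ H.scaling n p := by
  have h1 := h _ (H.span_isSubextension K hK)
  have hKv : K.card ≤ H.v := by simpa using Finset.card_le_univ K
  have hiK : H.iota ≤ K.card := by
    rw [← card_relabelRoots]; exact Finset.card_le_card hK
  have e1 : (H.span K hK).scaling n p =
      (n : ℝ) ^ (K.card - H.iota) * p ^ (H.span K hK).e := by
    rw [scaling, v_span]; rfl
  rw [e1] at h1
  have e2 : H.scaling n p = (n : ℝ) ^ (H.v - K.card) * p ^ (outerEdges H.relabel K).card *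
      ((n : ℝ) ^ (K.card - H.iota) * p ^ (H.span K hK).e) := by
    rw [scaling, ← H.e_span_add K hK,
      show H.v - H.iota = (H.v - K.card) + (K.card - H.iota) by omega]
    ring
  rw [e2]
  exact le_mul_of_one_le_right (by positivity) h1

theorem outer_scaling_le_one (H : RootedGraph ℕ) {n : ℕ} {p : ℝ}
    (h : ∀ (K : RootedGraph ℕ) (hK : K.IsSubextension H), (H.quotient K hK).scaling n p ≤ 1)
    (K : Finset (Fin H.v)) (hK : H.relabelRoots ⊆ K) :
    (n : ℝ) ^ (H.v - K.card) * p ^ (outerEdges H.relabel K).card ≤ 1 := by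
  have h1 := h _ (H.span_isSubextension K hK)
  rw [scaling, e_quotient_span] at h1
  have e1 : (H.quotient _ (H.span_isSubextension K hK)).iota = K.card := H.v_span K hK
  rw [e1] at h1
  exact h1

/-- With `d = v_H - ι_H`, `d + 1 ≤ exp d ≤ 3 exp d`. -/
theorem pow_le_rpow_rho (H : RootedGraph ℕ) {x : ℝ} (hx : 1 ≤ x) :
    x ^ (H.v - H.relabelRoots.card + 1) ≤ x ^ H.rho := by
  rw [← Real.rpow_natCast]
  refine Real.rpow_le_rpow_of_exponent_le hx ?_
  have hiv : H.iota ≤ H.v := Finset.card_le_card H.roots_subset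
  rw [card_relabelRoots, rho]
  push_cast [Nat.cast_sub hiv]
  have := Real.add_one_le_exp ((H.v : ℝ) - H.iota)
  have := Real.exp_pos ((H.v : ℝ) - H.iota)
  linarith

end RootedGraph

/-! ### Exceptional events and conclusion -/

open Classical in
/-- The trajectories in which, before `τ⋆`, some choice of roots has too many copies of `H`. The
threshold is the scaling of `H` if `b` is true and `1` otherwise, up to a power of `log n`. -/
def exceptional (C w : ℝ) (n : ℕ) {V : Type*} [Fintype V] (H : SimpleGraph V) (R : Finset V)
    (b : Bool) : Set (ℕ → SimpleGraph (Fin n)) :=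
  {g | ∃ i ≤ tauStar C w g, ∃ φ : V → Fin n,
    (∀ K : Finset V, R ⊆ K →
      (n : ℝ) ^ (Fintype.card V - K.card) * p n i ^ (outerEdges H K).card ≤
        if b then (n : ℝ) ^ (Fintype.card V - R.card) * p n i ^ H.edgeFinset.card else 1) ∧
    (if b then (n : ℝ) ^ (Fintype.card V - R.card) * p n i ^ H.edgeFinset.card else 1) *
      Real.log n ^ (Fintype.card V - R.card + 1) < (copies H R φ (g i)).card}

theorem tendsto_removalLaw_exceptional {V : Type*} [Fintype V] (H : SimpleGraph V)
    (R : Finset V) (b : Bool) {C : ℝ} (hC : 0 < C) {ω : ℕ → ℝ} (hω : Tendsto ω atTop atTop) :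
    Tendsto (fun n : ℕ => (removalLaw n).toOuterMeasure (exceptional C (ω n) n H R b))
      atTop (𝓝 0) :=
  tendsto_removalLaw_lt_card_copies H R hC hω _

theorem Psi_le_of_notMem_exceptional {C w : ℝ} (hC : 0 < C) {n : ℕ} (hn : 0 < n)
    (hl : 3 * C + 6 ≤ Real.log n) (hln : Real.log n ^ 8 ≤ n) (hw : 3 ≤ w)
    {g : ℕ → SimpleGraph (Fin n)} {i : ℕ} (hi : i ≤ tauStar C w g) (H : RootedGraph ℕ)
    (hg : ∀ b, g ∉ exceptional C w n H.relabel H.relabelRoots b) (φ : H.roots ↪ Fin n) :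
    ((∀ K : RootedGraph ℕ, K.IsSubextension H → 1 ≤ K.scaling n (p n i)) →
      (H.Psi (g i) φ : ℝ) ≤ H.scaling n (p n i) * Real.log n ^ H.rho) ∧
    ((∀ (K : RootedGraph ℕ) (hK : K.IsSubextension H),
        (H.quotient K hK).scaling n (p n i) ≤ 1) →
      (H.Psi (g i) φ : ℝ) ≤ Real.log n ^ H.rho) := by
  classical
  have hl1 : 1 < Real.log n := by linarith
  obtain ⟨-, hd⟩ := mem_controlled_of_le_tauStar hC hn hl1 hln hw hi
  -- Applied to the empty edge set, only for the positivity of `p` at time `i`, which may be `τ⋆`.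
  have hp : 0 < p n i :=
    (pathLaw_toOuterMeasure_subset_le_pow hC le_rfl hn (by linarith) hd ∅ (by simp)).1
  obtain ⟨φ', hφ'⟩ := H.Psi_le_card_copies hn φ
  have hΨ : (H.Psi (g i) φ : ℝ) ≤ (copies H.relabel H.relabelRoots φ' (g i)).card := by
    exact_mod_cast hφ' (g i)
  have hρ := H.pow_le_rpow_rho hl1.le
  have hS : H.scaling n (p n i) = (n : ℝ) ^ (Fintype.card (Fin H.v) - H.relabelRoots.card) *
      p n i ^ H.relabel.edgeFinset.card := by
    rw [RootedGraph.scaling, H.card_relabelRoots, Fintype.card_fin, H.e_eq_card]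
  constructor
  · intro h
    have h1 := H.outer_scaling_le_scaling hp.le h
    by_contra! hcon
    refine hg true ⟨i, hi, φ', ?_, ?_⟩
    · simp only [if_true]
      rw [← hS, Fintype.card_fin]
      exact h1
    · simp only [if_true]
      rw [← hS, Fintype.card_fin]
      refine lt_of_le_of_lt ?_ (hcon.trans_le hΨ)
      refine mul_le_mul_of_nonneg_left hρ ?_
      rw [hS]; positivity
  · intro h
    have h1 := H.outer_scaling_le_one h
    by_contra! hcon
    refine hg false ⟨i, hi, φ', ?_, ?_⟩
    · simp only [Bool.false_eq_true, if_false]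
      rw [Fintype.card_fin]
      exact h1
    · simp only [Bool.false_eq_true, if_false, one_mul]
      rw [Fintype.card_fin]
      exact hρ.trans_lt (hcon.trans_le hΨ)

end TriangleRemoval

end

theorem mainTheorem5 (L : ℕ) (C : ℝ) (hC : 0 < C) (ω : ℕ → ℝ) (hω : Tendsto ω atTop atTop) :
    ∃ ε : ℕ → ℝ, Tendsto ε atTop (𝓝 0) ∧
      Tendsto (fun n : ℕ => (TriangleRemoval.removalLaw n).toOuterMeasure
        {g | ∀ i : ℕ, 0 < i → i ≤ TriangleRemoval.tauStar C (ω n) g →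
          ∀ H : TriangleRemoval.RootedGraph ℕ, H.IsExtension → H.v ≤ L →
            ∀ φ : H.roots ↪ Fin n,
              ((∀ K : TriangleRemoval.RootedGraph ℕ, K.IsSubextension H →
                  1 ≤ K.scaling n (TriangleRemoval.p n i)) →
                (H.Psi (g i) φ : ℝ) ≤
                  (1 + ε n) * H.scaling n (TriangleRemoval.p n i) * Real.log n ^ H.rho) ∧
              ((∀ (K : TriangleRemoval.RootedGraph ℕ) (hK : K.IsSubextension H),
                  (H.quotient K hK).scaling n (TriangleRemoval.p n i) ≤ 1) →
                (H.Psi (g i) φ : ℝ) ≤ (1 + ε n) * Real.log n ^ H.rho)})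
        atTop (𝓝 1) := by
  classical
  -- No error term is needed: the constants are absorbed by the spare factor `log n`, and `ρ_H ≥ v_H
  -- - ι_H + 1`.
  refine ⟨fun _ => 0, tendsto_const_nhds, ?_⟩
  simp only [add_zero, one_mul]
  set good := fun n : ℕ => {g : ℕ → SimpleGraph (Fin n) |
    ∀ i : ℕ, 0 < i → i ≤ TriangleRemoval.tauStar C (ω n) g →
      ∀ H : TriangleRemoval.RootedGraph ℕ, H.IsExtension → H.v ≤ L →
        ∀ φ : H.roots ↪ Fin n,
          ((∀ K : TriangleRemoval.RootedGraph ℕ, K.IsSubextension H →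
              1 ≤ K.scaling n (TriangleRemoval.p n i)) →
            (H.Psi (g i) φ : ℝ) ≤
              H.scaling n (TriangleRemoval.p n i) * Real.log n ^ H.rho) ∧
          ((∀ (K : TriangleRemoval.RootedGraph ℕ) (hK : K.IsSubextension H),
              (H.quotient K hK).scaling n (TriangleRemoval.p n i) ≤ 1) →
            (H.Psi (g i) φ : ℝ) ≤ Real.log n ^ H.rho)}
  -- After relabelling, only finitely many graphs with roots occur, so the bad probabilities form a
  -- finite sum of null sequences.
  let X := (s : Fin (L + 1)) × (SimpleGraph (Fin s) × Finset (Fin s) × Bool)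
  let bad : (n : ℕ) → X → Set (ℕ → SimpleGraph (Fin n)) := fun n x =>
    TriangleRemoval.exceptional C (ω n) n x.2.1 x.2.2.1 x.2.2.2
  have hbad : Tendsto (fun n => ∑ x, (TriangleRemoval.removalLaw n).toOuterMeasure (bad n x))
      atTop (𝓝 0) := by
    have := tendsto_finsetSum (Finset.univ : Finset X) fun x _ =>
      TriangleRemoval.tendsto_removalLaw_exceptional x.2.1 x.2.2.1 x.2.2.2 hC hω
    rwa [Finset.sum_const_zero] at this
  have huniv : ∀ n, (TriangleRemoval.removalLaw n).toOuterMeasure Set.univ = 1 := fun n =>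
    (PMF.toOuterMeasure_apply_eq_one_iff _ _).2 (Set.subset_univ _)
  have hlog : Tendsto (fun n : ℕ => Real.log n) atTop atTop :=
    Real.tendsto_log_atTop.comp tendsto_natCast_atTop_atTop
  have hlow : Tendsto (fun n => 1 - ∑ x, (TriangleRemoval.removalLaw n).toOuterMeasure (bad n x))
      atTop (𝓝 1) := by
    simpa using ENNReal.Tendsto.sub (tendsto_const_nhds (x := (1 : ENNReal))) hbad
      (Or.inl ENNReal.one_ne_top)
  refine tendsto_of_tendsto_of_tendsto_of_le_of_le' hlow tendsto_const_nhds ?_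
    (Eventually.of_forall fun n =>
      (MeasureTheory.measure_mono (Set.subset_univ _)).trans_eq (huniv n))
  filter_upwards [hlog.eventually_ge_atTop (3 * C + 6),
    TriangleRemoval.eventually_log_pow_le, hω.eventually_ge_atTop 3, eventually_gt_atTop 0]
    with n hl h8 hw hn
  rw [tsub_le_iff_right]
  -- Subadditivity of the outer measure on this cover bounds the good event from below without any
  -- measurability.
  have hcover : Set.univ ⊆ good n ∪ ⋃ x ∈ (Finset.univ : Finset X), bad n x := by
    intro g _
    by_cases hg : ∃ x, g ∈ bad n x
    · obtain ⟨x, hx⟩ := hg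
      exact Or.inr (Set.mem_biUnion (Finset.mem_univ x) hx)
    · refine Or.inl fun i _ hi H _ hv φ =>
        TriangleRemoval.Psi_le_of_notMem_exceptional hC hn hl h8 hw hi H (fun b hb => hg ?_) φ
      exact ⟨⟨⟨H.v, Nat.lt_succ_of_le hv⟩, H.relabel, H.relabelRoots, b⟩, hb⟩
  rw [← huniv n]
  refine (MeasureTheory.measure_mono hcover).trans ((MeasureTheory.measure_union_le _ _).trans ?_)
  gcongr
  exact MeasureTheory.measure_biUnion_finset_le _ _
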